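/- **Machines.** Let $\Sigma$ be a finite nonempty alphabet and let $\lambda$ be the empty string. A one-way probabilistic pushdown automaton (1ppda) over a tape alphabet $T$ has a finite set $Q$ of states, a finite stack alphabet $\Gamma$, a finite set $\Theta\subseteq\Gamma^*$ with $\lambda\in\Theta$, transition probabilities $\delta(q,\sigma,a\,|\,p,u)\in[0,1]$ ($q,p\in Q$, $\sigma\in T\cup\{\lambda\}$, $a\in\Gamma$, $u\in\Theta$), an initial state $q_0$, a bottom marker $Z_0\in\Gamma$, and disjoint sets $Q_{acc},Q_{rej}\subseteq Q$. Here $\delta(q,\sigma,a\,|\,p,u)$ is the probability of passing from $q$ to $p$ and replacing the topmost stack symbol $a$ by $u$ while reading $\sigma$ (moving the head one cell to the right), or without reading and moving if $\sigma=\lambda$ (a $\lambda$-move). Whenever it is positive, $u\in(\Gamma\setminus\{Z_0\})^*$ if $a\ne Z_0$, and $u\in(\Gamma\setminus\{Z_0\})^*Z_0$ if $a=Z_0$. Put $\delta[q,\sigma,a]=\sum_{p,u}\delta(q,\sigma,a\,|\,p,u)$. The computation starts in state $q_0$, with stack $Z_0$ and the head on the first tape cell. A computation path has the product of the probabilities of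 its moves as its probability. *With two endmarkers:* $T=\Sigma\cup\{¢,\$\}$, and on input $x\in\Sigma^*$ the tape contains $¢x\$$. For every $q\notin Q_{acc}\cup Q_{rej}$, $\sigma\in T$ and $a\in\Gamma$, $\delta[q,\sigma,a]+\delta[q,\lambda,a]=1$. If $q_0\notin Q_{acc}\cup Q_{rej}$, then $\delta[q_0,\lambda,Z_0]=0$ (the first move reads $¢$). The machine halts as soon as it enters $Q_{acc}\cup Q_{rej}$; it may make $\lambda$-moves after reading $\$$. On every input, every computation path must reach a halting state after finitely many moves. The acceptance (rejection) probability of $x$ is the sum of the probabilities of the paths that halt in $Q_{acc}$ ($Q_{rej}$). *With no endmarkers:* $T=\Sigma$, the tape contains $x$, and $Q=Q_{acc}\cup Q_{rej}$. For $(q,a)\neq(q_0,Z_0)$ and $\sigma\in\Sigma$, $\delta[q,\sigma,a]+\delta[q,\lambda,a]=1$. On a nonempty input, the machine in state $q_0$ with topmost symbol $Z_0$ must read a symbol: $\delta[q_0,\sigma,Z_0]=1$ for all $\sigma\in\Sigma$, and no $\lambda$-move is made there. On the empty input it may make $\lambda$-moves there, with $\delta[q_0,\lambda,Z_0]\le 1$.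 Entering a state of $Q_{acc}$ or $Q_{rej}$ does not stop the machine. Once the input has been read completely, the machine in state $q$ with topmost symbol $a$ makes a $\lambda$-move with the total probability of the $\lambda$-moves available there and stops with the remaining probability; its state then decides acceptance ($Q_{acc}$) or rejection ($Q_{rej}$). On every input, every computation path must be finite. The acceptance (rejection) probability of $x$ is the sum of the probabilities of the paths that stop in $Q_{acc}$ ($Q_{rej}$). A machine recognizes $L\subseteq\Sigma^*$ *with error probability $\varepsilon(x)$ on every input $x$* if each $x\in L$ is accepted with probability exactly $1-\varepsilon(x)$ and rejected with probability exactly $\varepsilon(x)$, and each $x\in\Sigma^*\setminus L$ is rejected with probability exactly $1-\varepsilon(x)$ and accepted with probability exactly $\varepsilon(x)$. **Theorem (No Endmarker Theorem).** Let $L\subseteq\Sigma^*$ be a language and let $\varepsilon:\Sigma^*\to[0,1/2)$; or, in the one-sided case, let $\varepsilon:\Sigma^*\to[0,1)$ vanish on all of $L$ or on all of $\Sigma^*\setminus L$. The following are equivalent. 1. Some 1ppda with two endmarkers recognizes $L$ with error probability $\varepsilon(x)$ on every input $x$. 2. Some 1ppda with no endmarkers recognizes $L$ with error probability $\varepsilon(x)$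 on every input $x$. -/

import Mathlib

universe u

/-- The tape alphabet `A ∪ {¢, $}`: `left` is `¢`, `right` is `$`. -/
inductive Marked (A : Type u) : Type u
  | left : Marked A
  | sym : A → Marked A
  | right : Marked A

/-- The content `¢ x $` of the input tape of a machine with two endmarkers. -/
def Marked.tape {A : Type u} (x : List A) : List (Marked A) :=
  Marked.left :: (x.map Marked.sym ++ [Marked.right])

/-- The components common to both kinds of one-way probabilistic pushdown automata over the tape
alphabet `A`. `δ q σ a p v` is the probability of going from state `q` to state `p` and replacing
the topmost stack symbol `a` by the string `v` (leftmost symbol on top) while reading `σ`;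
`σ = none` is a `λ`-move. -/
structure PPDA (A : Type u) where
  Q : Type u
  Γ : Type u
  [fintypeQ : Fintype Q]
  [finiteΓ : Finite Γ]
  /-- The finite set of strings that may be written on the stack in one move. -/
  Θ : Finset (List Γ)
  nil_mem : [] ∈ Θ
  δ : Q → Option A → Γ → Q → List Γ → ℝ
  δ_mem : ∀ q σ a p v, δ q σ a p v ∈ Set.Icc (0 : ℝ) 1
  δ_supp : ∀ q σ a p v, v ∉ Θ → δ q σ a p v = 0
  q₀ : Q
  /-- The bottom marker. -/
  Z₀ : Γ
  Qacc : Set Q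
  Qrej : Set Q
  disj : Disjoint Qacc Qrej
  /-- The bottom marker is never removed and occurs only at the bottom of the stack. -/
  bottom : ∀ q σ a p v, 0 < δ q σ a p v →
    (a ≠ Z₀ → Z₀ ∉ v) ∧ (a = Z₀ → ∃ v', Z₀ ∉ v' ∧ v = v' ++ [Z₀])

attribute [instance] PPDA.fintypeQ PPDA.finiteΓ

/-- A configuration: inner state, the part of the tape content that has not been read yet (which
encodes the head position, as the head only moves to the right), and stack content, top first. -/
structure PPDA.Config {A : Type u} (M : PPDA A) where
  state : M.Q
  rest : List A
  stack : List M.Γ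

/-- `δ[q, σ, a]`, the total probability of the moves on `σ` in state `q` with topmost symbol `a`. -/
noncomputable def PPDA.total {A : Type u} (M : PPDA A) (q : M.Q) (σ : Option A) (a : M.Γ) : ℝ :=
  ∑ p, ∑ v ∈ M.Θ, M.δ q σ a p v

/-- The initial configuration on a given tape content. -/
def PPDA.init {A : Type u} (M : PPDA A) (t : List A) : M.Config := ⟨M.q₀, t, [M.Z₀]⟩

/-! ### Machines with two endmarkers -/

/-- The set of halting states. -/
def PPDA.Qhalt {A : Type u} (M : PPDA A) : Set M.Q := M.Qacc ∪ M.Qrej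

/-- One move of positive probability of a machine that stops as soon as it is in a halting
state. -/
inductive PPDA.Step {A : Type u} (M : PPDA A) : M.Config → M.Config → Prop
  | read (q : M.Q) (σ : A) (r : List A) (a : M.Γ) (w : List M.Γ) (p : M.Q) (v : List M.Γ) :
      q ∉ M.Qhalt → 0 < M.δ q (some σ) a p v → PPDA.Step M ⟨q, σ :: r, a :: w⟩ ⟨p, r, v ++ w⟩
  | lam (q : M.Q) (r : List A) (a : M.Γ) (w : List M.Γ) (p : M.Q) (v : List M.Γ) :
      q ∉ M.Qhalt → 0 < M.δ q none a p v → PPDA.Step M ⟨q, r, a :: w⟩ ⟨p, r, v ++ w⟩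

open Classical in
/-- The sum of the probabilities of all computation paths that start in the given configuration,
make exactly `n` moves and end in a halting state belonging to `S` (no earlier state being
halting). -/
noncomputable def PPDA.haltProb {A : Type u} (M : PPDA A) (S : Set M.Q) : ℕ → M.Config → ℝ
  | 0, c => if c.state ∈ M.Qhalt ∧ c.state ∈ S then 1 else 0
  | _ + 1, ⟨_, _, []⟩ => 0
  | n + 1, ⟨q, [], a :: w⟩ =>
      if q ∈ M.Qhalt then 0 else
        ∑ p, ∑ v ∈ M.Θ, M.δ q none a p v * M.haltProb S n ⟨p, [], v ++ w⟩
  | n + 1, ⟨q, σ :: r, a :: w⟩ =>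
      if q ∈ M.Qhalt then 0 else
        ∑ p, ∑ v ∈ M.Θ, (M.δ q none a p v * M.haltProb S n ⟨p, σ :: r, v ++ w⟩ +
          M.δ q (some σ) a p v * M.haltProb S n ⟨p, r, v ++ w⟩)

/-- A one-way probabilistic pushdown automaton with two endmarkers over the alphabet `A`. -/
structure EndmarkerPPDA (A : Type u) extends PPDA (Marked A) where
  prob : ∀ q, q ∉ toPPDA.Qhalt → ∀ σ a, toPPDA.total q (some σ) a + toPPDA.total q none a = 1
  /-- The first move reads the leftmost tape symbol. -/
  start : q₀ ∉ toPPDA.Qhalt → toPPDA.total q₀ none Z₀ = 0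
  /-- No computation path is infinite. -/
  finite_paths : ∀ x : List A, ¬ ∃ c : ℕ → toPPDA.Config,
    c 0 = toPPDA.init (Marked.tape x) ∧ ∀ n, toPPDA.Step (c n) (c (n + 1))
  /-- No computation path gets stuck in a non-halting state after the whole tape has been read. -/
  not_stuck : ∀ (x : List A) (q : Q) (a : Γ) (w : List Γ),
    Relation.ReflTransGen toPPDA.Step (toPPDA.init (Marked.tape x)) ⟨q, [], a :: w⟩ →
      q ∉ toPPDA.Qhalt → toPPDA.total q none a = 1

/-- The acceptance probability. -/
noncomputable def EndmarkerPPDA.accProb {A : Type u} (M : EndmarkerPPDA A) (x : List A) : ℝ :=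
  ∑' n, M.haltProb M.Qacc n (M.init (Marked.tape x))

/-- The rejection probability. -/
noncomputable def EndmarkerPPDA.rejProb {A : Type u} (M : EndmarkerPPDA A) (x : List A) : ℝ :=
  ∑' n, M.haltProb M.Qrej n (M.init (Marked.tape x))

/-! ### Machines without endmarkers -/

open Classical in
/-- The probability of a `λ`-move on input `x`. On a non-empty input the machine in its initial
situation (state `q₀`, only the bottom marker on the stack) must read an input symbol; on the empty
input, where there is nothing to read, it may make a `λ`-move. -/
noncomputable def PPDA.lamδ {A : Type u} (M : PPDA A) (x : List A) (q : M.Q) (a : M.Γ) (p : M.Q)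
    (v : List M.Γ) : ℝ :=
  if x ≠ [] ∧ q = M.q₀ ∧ a = M.Z₀ then 0 else M.δ q none a p v

/-- One move of positive probability of a machine without endmarkers on input `x`; the machine
goes on reading whatever its inner state is. -/
inductive PPDA.FreeStep {A : Type u} (M : PPDA A) (x : List A) : M.Config → M.Config → Prop
  | read (q : M.Q) (σ : A) (r : List A) (a : M.Γ) (w : List M.Γ) (p : M.Q) (v : List M.Γ) :
      0 < M.δ q (some σ) a p v → PPDA.FreeStep M x ⟨q, σ :: r, a :: w⟩ ⟨p, r, v ++ w⟩
  | lam (q : M.Q) (r : List A) (a : M.Γ) (w : List M.Γ) (p : M.Q) (v : List M.Γ) :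
      0 < M.lamδ x q a p v → PPDA.FreeStep M x ⟨q, r, a :: w⟩ ⟨p, r, v ++ w⟩

open Classical in
/-- The sum of the probabilities of all computation paths on input `x` that start in the given
configuration, make exactly `n` moves and then stop, the whole input having been read, in a state
belonging to `S`. Once the input has been read off, the machine makes a further `λ`-move with the
total probability of its `λ`-moves, and stops with the remaining probability. -/
noncomputable def PPDA.stopProb {A : Type u} (M : PPDA A) (x : List A) (S : Set M.Q) :
    ℕ → M.Config → ℝ
  | _, ⟨_, _, []⟩ => 0
  | 0, ⟨_, _ :: _, _ :: _⟩ => 0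
  | 0, ⟨q, [], a :: _⟩ => if q ∈ S then 1 - ∑ p, ∑ v ∈ M.Θ, M.lamδ x q a p v else 0
  | n + 1, ⟨q, [], a :: w⟩ =>
      ∑ p, ∑ v ∈ M.Θ, M.lamδ x q a p v * M.stopProb x S n ⟨p, [], v ++ w⟩
  | n + 1, ⟨q, σ :: r, a :: w⟩ =>
      ∑ p, ∑ v ∈ M.Θ, (M.lamδ x q a p v * M.stopProb x S n ⟨p, σ :: r, v ++ w⟩ +
        M.δ q (some σ) a p v * M.stopProb x S n ⟨p, r, v ++ w⟩)

/-- A one-way probabilistic pushdown automaton with no endmarkers over the alphabet `A`. -/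
structure NoEndmarkerPPDA (A : Type u) extends PPDA A where
  /-- Every state is accepting or rejecting. -/
  cover : Qacc ∪ Qrej = Set.univ
  prob : ∀ q a, ¬ (q = q₀ ∧ a = Z₀) → ∀ σ, toPPDA.total q (some σ) a + toPPDA.total q none a = 1
  /-- In the initial situation on a non-empty input, a symbol is read with probability one. -/
  start_read : ∀ σ, toPPDA.total q₀ (some σ) Z₀ = 1
  /-- In the initial situation on the empty input, `λ`-moves are allowed. -/
  start_lam : toPPDA.total q₀ none Z₀ ≤ 1
  /-- No computation path is infinite. -/
  finite_paths : ∀ x : List A, ¬ ∃ c : ℕ → toPPDA.Config,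
    c 0 = toPPDA.init x ∧ ∀ n, toPPDA.FreeStep x (c n) (c (n + 1))

/-- The acceptance probability. -/
noncomputable def NoEndmarkerPPDA.accProb {A : Type u} (M : NoEndmarkerPPDA A) (x : List A) : ℝ :=
  ∑' n, M.stopProb x M.Qacc n (M.init x)

/-- The rejection probability. -/
noncomputable def NoEndmarkerPPDA.rejProb {A : Type u} (M : NoEndmarkerPPDA A) (x : List A) : ℝ :=
  ∑' n, M.stopProb x M.Qrej n (M.init x)

/-! ### Recognition -/

/-- A machine with acceptance probability `acc` and rejection probability `rej` recognizes `L` with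
error probability (exactly) `ε x` on every input `x`. If `ε x < 1 / 2` for all `x`, this forces
`L = {x | acc x > 1 / 2}`. -/
def RecognizesWithError {A : Type u} (acc rej : List A → ℝ) (L : Language A) (ε : List A → ℝ) :
    Prop :=
  ∀ x, (x ∈ L → acc x = 1 - ε x ∧ rej x = ε x) ∧ (x ∉ L → rej x = 1 - ε x ∧ acc x = ε x)

/-- `ε` is a one-sided error bound for `L`: values in `[0, 1)`, and no error on one of `L` and its
complement. -/
def IsOneSidedBound {A : Type u} (L : Language A) (ε : List A → ℝ) : Prop :=
  (∀ x, 0 ≤ ε x ∧ ε x < 1) ∧ ((∀ x ∈ L, ε x = 0) ∨ (∀ x, x ∉ L → ε x = 0))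

/-! From no endmarkers to two endmarkers, reading `$` replaces stopping. On a nonempty input
`markedPPDA` makes the λ-moves of the given machine and reads `$` with the probability they leave
over, which is the probability of stopping once the input is exhausted. The empty input may have
λ-moves of its own in the initial situation; it is recognised by `$` coming right after `¢` and is
simulated from then on in the separate states `after`.

In the other direction the difficulty is that after `$` the machine may go on with λ-moves deep into
its stack, whereas a machine without endmarkers should have the outcome in its state when the input
ends. The remedy is a random prediction stored in the stack. Each symbol carries a Boolean function
on the states, predicting for every state `q` whether the run from `q` on the stack below that
symbol, with no input left, accepts. Above a stack with prediction `f`, the prediction for the stack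
enlarged by `a` is drawn with means `popVal f q [a]`: the probability of accepting before `a` is
popped, or of popping it into a state that `f` approves. These probabilities are affine in `f`, so
by linearity of expectation the means are exactly the acceptance probabilities
(`linearCombination_popVal`, `linearCombination_ann_toReal`); correlations do not matter. The law of
an annotated stack is built from the bottom upwards (`linearCombination_ann_append`) and the
simulated moves ignore the predictions, so every move preserves it. Before each move the simulation
draws the result to be given if the input ends here (`endProb`). Averaged over the predictions, its
acceptance probability is that of the original configuration (`linearCombination_freeVal_look`).

Reading the first input symbol simulates the move on `¢`; the symbol is kept in the state `pend`
until a λ-move consumes it. The empty input is settled by one λ-move whose probability is the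
desired acceptance probability. Rejection probabilities then agree because on both sides acceptance
and rejection sum to one (`accProb_add_rejProb`). -/

open scoped Classical

/-! ### Averages over moves -/

namespace PPDA

variable {A : Type u} (M : PPDA A)

/-- The weighted sum of `X` over the moves on `σ` in state `q` with topmost symbol `a`. -/
noncomputable def avg (q : M.Q) (σ : Option A) (a : M.Γ) (X : M.Q → List M.Γ → ℝ) : ℝ :=
  ∑ p, ∑ v ∈ M.Θ, M.δ q σ a p v * X p v

variable {M}

lemma δ_nonneg (q : M.Q) (σ : Option A) (a : M.Γ) (p : M.Q) (v : List M.Γ) :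
    0 ≤ M.δ q σ a p v := (M.δ_mem q σ a p v).1

/-- Only moves of positive probability are steps, so this form lets an induction hypothesis about
successor configurations be applied under the average. -/
lemma avg_congr {q : M.Q} {σ : Option A} {a : M.Γ} {X Y : M.Q → List M.Γ → ℝ}
    (h : ∀ p v, 0 < M.δ q σ a p v → X p v = Y p v) : M.avg q σ a X = M.avg q σ a Y := by
  refine Finset.sum_congr rfl fun p _ => Finset.sum_congr rfl fun v _ => ?_
  rcases (δ_nonneg q σ a p v).eq_or_lt with h0 | h0
  · simp [← h0]
  · rw [h p v h0]

lemma avg_mono {q : M.Q} {σ : Option A} {a : M.Γ} {X Y : M.Q → List M.Γ → ℝ}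
    (h : ∀ p v, X p v ≤ Y p v) : M.avg q σ a X ≤ M.avg q σ a Y :=
  Finset.sum_le_sum fun p _ => Finset.sum_le_sum fun v _ =>
    mul_le_mul_of_nonneg_left (h p v) (δ_nonneg q σ a p v)

lemma avg_nonneg {q : M.Q} {σ : Option A} {a : M.Γ} {X : M.Q → List M.Γ → ℝ}
    (h : ∀ p v, 0 ≤ X p v) : 0 ≤ M.avg q σ a X :=
  Finset.sum_nonneg fun p _ => Finset.sum_nonneg fun v _ =>
    mul_nonneg (δ_nonneg q σ a p v) (h p v)

lemma avg_one (q : M.Q) (σ : Option A) (a : M.Γ) :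
    M.avg q σ a (fun _ _ => 1) = M.total q σ a := by simp [avg, total]

lemma avg_add (q : M.Q) (σ : Option A) (a : M.Γ) (X Y : M.Q → List M.Γ → ℝ) :
    M.avg q σ a (fun p v => X p v + Y p v) = M.avg q σ a X + M.avg q σ a Y := by
  simp [avg, mul_add, Finset.sum_add_distrib]

lemma avg_sum {ι : Type*} (s : Finset ι) (q : M.Q) (σ : Option A) (a : M.Γ)
    (X : ι → M.Q → List M.Γ → ℝ) :
    M.avg q σ a (fun p v => ∑ i ∈ s, X i p v) = ∑ i ∈ s, M.avg q σ a (X i) := by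
  simp only [avg, Finset.mul_sum]
  rw [Finset.sum_comm]
  simp_rw [Finset.sum_comm (s := s)]
  rw [Finset.sum_comm]

lemma total_nonneg (q : M.Q) (σ : Option A) (a : M.Γ) : 0 ≤ M.total q σ a := by
  rw [← avg_one]; exact avg_nonneg fun _ _ => zero_le_one

lemma avg_eq_zero_of_total {q : M.Q} {σ : Option A} {a : M.Γ} (h : M.total q σ a = 0)
    (X : M.Q → List M.Γ → ℝ) : M.avg q σ a X = 0 := by
  have h1 := (Finset.sum_eq_zero_iff_of_nonneg fun p _ =>
    Finset.sum_nonneg fun v _ => δ_nonneg q σ a p v).1 h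
  refine Finset.sum_eq_zero fun p hp => Finset.sum_eq_zero fun v hv => ?_
  rw [(Finset.sum_eq_zero_iff_of_nonneg fun v _ => δ_nonneg q σ a p v).1 (h1 p hp) v hv, zero_mul]

lemma hasSum_avg {q : M.Q} {σ : Option A} {a : M.Γ} {f : ℕ → M.Q → List M.Γ → ℝ}
    (h : ∀ p v, 0 < M.δ q σ a p v → Summable fun n => f n p v) :
    HasSum (fun n => M.avg q σ a (f n)) (M.avg q σ a fun p v => ∑' n, f n p v) := by
  refine hasSum_sum fun p _ => hasSum_sum fun v _ => ?_
  rcases (δ_nonneg q σ a p v).eq_or_lt with h0 | h0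
  · simp [← h0]
  · exact (h p v h0).hasSum.mul_left _

lemma linearCombination_avg {α : Type*} (μ : α →₀ ℝ) (q : M.Q) (σ : Option A) (a : M.Γ)
    (K : M.Q → List M.Γ → α → ℝ) :
    Finsupp.linearCombination ℝ (fun y => M.avg q σ a fun p v => K p v y) μ =
      M.avg q σ a fun p v => Finsupp.linearCombination ℝ (K p v) μ := by
  simp only [Finsupp.linearCombination_apply, Finsupp.sum, smul_eq_mul]
  rw [avg_sum]
  refine Finset.sum_congr rfl fun y _ => ?_
  simp only [avg, Finset.mul_sum]
  refine Finset.sum_congr rfl fun p _ => Finset.sum_congr rfl fun v _ => ?_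
  ring

/-! ### The value of a configuration of a machine that halts -/

variable (M)

/-- No computation path that starts in `c` is infinite. -/
def Halts (c : M.Config) : Prop := Acc (fun c' c => M.Step c c') c

/-- The probability of halting in a state belonging to `S`. -/
noncomputable def haltVal (S : Set M.Q) (c : M.Config) : ℝ := ∑' n, M.haltProb S n c

variable {M}

lemma Halts.step {c c' : M.Config} (h : M.Halts c) (hs : M.Step c c') : M.Halts c' := h.inv hs

lemma haltProb_nonneg (S : Set M.Q) (n : ℕ) (c : M.Config) : 0 ≤ M.haltProb S n c := by
  induction n generalizing c with
  | zero => unfold haltProb; split_ifs <;> norm_num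
  | succ n ih =>
    obtain ⟨q, r, w⟩ := c
    rcases w with _ | ⟨a, w⟩
    · simp [haltProb]
    rcases r with _ | ⟨σ, r⟩ <;> simp only [haltProb] <;> split_ifs <;> try exact le_rfl
    · exact Finset.sum_nonneg fun p _ => Finset.sum_nonneg fun v _ =>
        mul_nonneg (δ_nonneg ..) (ih _)
    · exact Finset.sum_nonneg fun p _ => Finset.sum_nonneg fun v _ =>
        add_nonneg (mul_nonneg (δ_nonneg ..) (ih _)) (mul_nonneg (δ_nonneg ..) (ih _))

lemma haltProb_succ_nil {S : Set M.Q} {n : ℕ} {q : M.Q} (hq : q ∉ M.Qhalt) (a : M.Γ)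
    (w : List M.Γ) : M.haltProb S (n + 1) ⟨q, [], a :: w⟩ =
      M.avg q none a fun p v => M.haltProb S n ⟨p, [], v ++ w⟩ := by
  simp [haltProb, hq, avg]

lemma haltProb_succ_cons {S : Set M.Q} {n : ℕ} {q : M.Q} (hq : q ∉ M.Qhalt) (σ : A) (r : List A)
    (a : M.Γ) (w : List M.Γ) : M.haltProb S (n + 1) ⟨q, σ :: r, a :: w⟩ =
      M.avg q none a (fun p v => M.haltProb S n ⟨p, σ :: r, v ++ w⟩) +
        M.avg q (some σ) a fun p v => M.haltProb S n ⟨p, r, v ++ w⟩ := by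
  simp [haltProb, hq, avg, Finset.sum_add_distrib]

lemma haltProb_succ_of_mem {S : Set M.Q} {n : ℕ} {q : M.Q} (hq : q ∈ M.Qhalt) (r : List A)
    (w : List M.Γ) : M.haltProb S (n + 1) ⟨q, r, w⟩ = 0 := by
  rcases w with _ | ⟨a, w⟩ <;> rcases r with _ | ⟨σ, r⟩ <;> simp [haltProb, hq]

lemma haltVal_of_mem {S : Set M.Q} {q : M.Q} (hq : q ∈ M.Qhalt) (r : List A) (w : List M.Γ) :
    M.haltVal S ⟨q, r, w⟩ = if q ∈ S then 1 else 0 := by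
  rw [haltVal, tsum_eq_single 0]
  · simp [haltProb, hq]
  · rintro (_ | n) hn
    · exact absurd rfl hn
    · exact haltProb_succ_of_mem hq r w

/-- A computation from the initial configuration never empties its stack; this value is the base of
the induction along the stack in `linearCombination_ann_toReal`. -/
lemma haltVal_empty {S : Set M.Q} {q : M.Q} (hq : q ∉ M.Qhalt) (r : List A) :
    M.haltVal S ⟨q, r, []⟩ = 0 := by
  rw [haltVal, ← tsum_zero (β := ℕ)]
  congr 1
  ext n
  rcases n with _ | n
  · simp [haltProb, hq]
  · simp [haltProb]

/-- Dropping the term of index zero leaves a finite weighted sum of the series of the successor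
configurations, so induction on accessibility applies. -/
lemma Halts.summable {c : M.Config} (h : M.Halts c) (S : Set M.Q) :
    Summable fun n => M.haltProb S n c := by
  induction h with
  | intro c h ih =>
  obtain ⟨q, r, w⟩ := c
  rw [← summable_nat_add_iff 1]
  by_cases hq : q ∈ M.Qhalt
  · simp [haltProb_succ_of_mem hq, summable_zero]
  rcases w with _ | ⟨a, w⟩
  · simp [haltProb, summable_zero]
  rcases r with _ | ⟨σ, r⟩
  · simp only [haltProb_succ_nil hq]
    exact (hasSum_avg fun p v hp => ih _ (.lam _ _ _ _ _ _ hq hp)).summable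
  · simp only [haltProb_succ_cons hq]
    exact (hasSum_avg fun p v hp => ih _ (.lam _ _ _ _ _ _ hq hp)).summable.add
      (hasSum_avg fun p v hp => ih _ (.read _ _ _ _ _ _ _ hq hp)).summable

lemma haltVal_nil {S : Set M.Q} {q : M.Q} (hq : q ∉ M.Qhalt) {a : M.Γ} {w : List M.Γ}
    (h : M.Halts ⟨q, [], a :: w⟩) : M.haltVal S ⟨q, [], a :: w⟩ =
      M.avg q none a fun p v => M.haltVal S ⟨p, [], v ++ w⟩ := by
  rw [haltVal, (h.summable S).tsum_eq_zero_add]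
  simp only [haltProb_succ_nil hq]
  rw [(hasSum_avg fun p v hp => (h.step (.lam _ _ _ _ _ _ hq hp)).summable S).tsum_eq]
  simp [haltProb, hq, haltVal]

lemma haltVal_cons {S : Set M.Q} {q : M.Q} (hq : q ∉ M.Qhalt) {σ : A} {r : List A} {a : M.Γ}
    {w : List M.Γ} (h : M.Halts ⟨q, σ :: r, a :: w⟩) : M.haltVal S ⟨q, σ :: r, a :: w⟩ =
      M.avg q none a (fun p v => M.haltVal S ⟨p, σ :: r, v ++ w⟩) +
        M.avg q (some σ) a fun p v => M.haltVal S ⟨p, r, v ++ w⟩ := by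
  rw [haltVal, (h.summable S).tsum_eq_zero_add]
  simp only [haltProb_succ_cons hq]
  rw [((hasSum_avg fun p v hp => (h.step (.lam _ _ _ _ _ _ hq hp)).summable S).add
    (hasSum_avg fun p v hp => (h.step (.read _ _ _ _ _ _ _ hq hp)).summable S)).tsum_eq]
  simp [haltProb, hq, haltVal]

/-! ### The value of a configuration of a machine that reads to the end -/

variable (M)

/-- The weighted sum of `X` over the `λ`-moves on input `x`. -/
noncomputable def lamAvg (x : List A) (q : M.Q) (a : M.Γ) (X : M.Q → List M.Γ → ℝ) : ℝ :=
  if x ≠ [] ∧ q = M.q₀ ∧ a = M.Z₀ then 0 else M.avg q none a X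

/-- No computation path on input `x` that starts in `c` is infinite. -/
def FreeHalts (x : List A) (c : M.Config) : Prop := Acc (fun c' c => M.FreeStep x c c') c

/-- The probability of stopping in a state belonging to `S`. -/
noncomputable def stopVal (x : List A) (S : Set M.Q) (c : M.Config) : ℝ :=
  ∑' n, M.stopProb x S n c

variable {M}

lemma FreeHalts.step {x : List A} {c c' : M.Config} (h : M.FreeHalts x c)
    (hs : M.FreeStep x c c') : M.FreeHalts x c' := h.inv hs

lemma sum_lamδ_mul (x : List A) (q : M.Q) (a : M.Γ) (X : M.Q → List M.Γ → ℝ) :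
    ∑ p, ∑ v ∈ M.Θ, M.lamδ x q a p v * X p v = M.lamAvg x q a X := by
  unfold lamAvg lamδ avg
  split_ifs <;> simp

lemma sum_lamδ (x : List A) (q : M.Q) (a : M.Γ) :
    ∑ p, ∑ v ∈ M.Θ, M.lamδ x q a p v = M.lamAvg x q a fun _ _ => 1 := by
  simp [← sum_lamδ_mul]

lemma lamAvg_congr {x : List A} {q : M.Q} {a : M.Γ} {X Y : M.Q → List M.Γ → ℝ}
    (h : ∀ p v, 0 < M.lamδ x q a p v → X p v = Y p v) :
    M.lamAvg x q a X = M.lamAvg x q a Y := by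
  unfold lamAvg
  split_ifs with h0
  · rfl
  · exact avg_congr fun p v hp => h p v (by rwa [lamδ, if_neg h0])

lemma lamAvg_add (x : List A) (q : M.Q) (a : M.Γ) (X Y : M.Q → List M.Γ → ℝ) :
    M.lamAvg x q a (fun p v => X p v + Y p v) = M.lamAvg x q a X + M.lamAvg x q a Y := by
  unfold lamAvg
  split_ifs
  · simp
  · exact avg_add ..

lemma hasSum_lamAvg {x : List A} {q : M.Q} {a : M.Γ} {f : ℕ → M.Q → List M.Γ → ℝ}
    (h : ∀ p v, 0 < M.lamδ x q a p v → Summable fun n => f n p v) :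
    HasSum (fun n => M.lamAvg x q a (f n)) (M.lamAvg x q a fun p v => ∑' n, f n p v) := by
  unfold lamAvg
  split_ifs with h0
  · exact hasSum_zero
  · exact hasSum_avg fun p v hp => h p v (by rwa [lamδ, if_neg h0])

lemma stopProb_succ_nil (x : List A) (S : Set M.Q) (n : ℕ) (q : M.Q) (a : M.Γ)
    (w : List M.Γ) : M.stopProb x S (n + 1) ⟨q, [], a :: w⟩ =
      M.lamAvg x q a fun p v => M.stopProb x S n ⟨p, [], v ++ w⟩ := by
  rw [stopProb, sum_lamδ_mul]

lemma stopProb_succ_cons (x : List A) (S : Set M.Q) (n : ℕ) (q : M.Q) (σ : A) (r : List A)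
    (a : M.Γ) (w : List M.Γ) : M.stopProb x S (n + 1) ⟨q, σ :: r, a :: w⟩ =
      M.lamAvg x q a (fun p v => M.stopProb x S n ⟨p, σ :: r, v ++ w⟩) +
        M.avg q (some σ) a fun p v => M.stopProb x S n ⟨p, r, v ++ w⟩ := by
  rw [stopProb, ← sum_lamδ_mul]
  simp [avg, Finset.sum_add_distrib]

lemma stopVal_empty (x : List A) (S : Set M.Q) (q : M.Q) (r : List A) :
    M.stopVal x S ⟨q, r, []⟩ = 0 := by
  simp [stopVal, stopProb]

lemma FreeHalts.summable {x : List A} {c : M.Config} (h : M.FreeHalts x c) (S : Set M.Q) :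
    Summable fun n => M.stopProb x S n c := by
  induction h with
  | intro c h ih =>
  obtain ⟨q, r, w⟩ := c
  rw [← summable_nat_add_iff 1]
  rcases w with _ | ⟨a, w⟩
  · simp [stopProb, summable_zero]
  rcases r with _ | ⟨σ, r⟩
  · simp only [stopProb_succ_nil]
    exact (hasSum_lamAvg fun p v hp => ih _ (.lam _ _ _ _ _ _ hp)).summable
  · simp only [stopProb_succ_cons]
    exact (hasSum_lamAvg fun p v hp => ih _ (.lam _ _ _ _ _ _ hp)).summable.add
      (hasSum_avg fun p v hp => ih _ (.read _ _ _ _ _ _ _ hp)).summable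

/-- The term of index zero is the probability of stopping at once. -/
lemma stopVal_nil {x : List A} (S : Set M.Q) {q : M.Q} {a : M.Γ} {w : List M.Γ}
    (h : M.FreeHalts x ⟨q, [], a :: w⟩) : M.stopVal x S ⟨q, [], a :: w⟩ =
      (if q ∈ S then 1 - M.lamAvg x q a (fun _ _ => 1) else 0) +
        M.lamAvg x q a fun p v => M.stopVal x S ⟨p, [], v ++ w⟩ := by
  rw [stopVal, (h.summable S).tsum_eq_zero_add]
  simp only [stopProb_succ_nil]
  rw [(hasSum_lamAvg fun p v hp => (h.step (.lam _ _ _ _ _ _ hp)).summable S).tsum_eq]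
  simp [stopProb, sum_lamδ, stopVal]

lemma stopVal_cons {x : List A} (S : Set M.Q) {q : M.Q} {σ : A} {r : List A} {a : M.Γ}
    {w : List M.Γ} (h : M.FreeHalts x ⟨q, σ :: r, a :: w⟩) :
    M.stopVal x S ⟨q, σ :: r, a :: w⟩ =
      M.lamAvg x q a (fun p v => M.stopVal x S ⟨p, σ :: r, v ++ w⟩) +
        M.avg q (some σ) a fun p v => M.stopVal x S ⟨p, r, v ++ w⟩ := by
  rw [stopVal, (h.summable S).tsum_eq_zero_add]
  simp only [stopProb_succ_cons]
  rw [((hasSum_lamAvg fun p v hp => (h.step (.lam _ _ _ _ _ _ hp)).summable S).add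
    (hasSum_avg fun p v hp => (h.step (.read _ _ _ _ _ _ _ hp)).summable S)).tsum_eq]
  simp [stopProb, stopVal]

end PPDA

/-! ### Well-founded computations, the bottom marker, and deciding with probability one -/

lemma EndmarkerPPDA.halts_init {A : Type u} (M : EndmarkerPPDA A) (x : List A) :
    M.Halts (M.init (Marked.tape x)) := by
  by_contra h
  exact M.finite_paths x (not_acc_iff_exists_descending_chain.1 h)

lemma NoEndmarkerPPDA.freeHalts_init {A : Type u} (N : NoEndmarkerPPDA A) (x : List A) :
    N.FreeHalts x (N.init x) := by
  by_contra h
  exact N.finite_paths x (not_acc_iff_exists_descending_chain.1 h)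

lemma EndmarkerPPDA.total_none_le_one {A : Type u} (M : EndmarkerPPDA A) {q : M.Q}
    (hq : q ∉ M.Qhalt) (a : M.Γ) : M.total q none a ≤ 1 := by
  have := M.prob q hq .left a
  have := PPDA.total_nonneg (M := M.toPPDA) q (some .left) a
  linarith

lemma NoEndmarkerPPDA.total_none_le_one {A : Type u} [Nonempty A] (N : NoEndmarkerPPDA A)
    (q : N.Q) (a : N.Γ) : N.total q none a ≤ 1 := by
  by_cases h : q = N.q₀ ∧ a = N.Z₀
  · rw [h.1, h.2]; exact N.start_lam
  · obtain ⟨σ⟩ := ‹Nonempty A›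
    have := N.prob q a h σ
    have := PPDA.total_nonneg (M := N.toPPDA) q (some σ) a
    linarith

/-- A move keeps the bottom marker at the bottom. -/
lemma PPDA.bottom_append {A : Type u} {M : PPDA A} {q : M.Q} {σ : Option A} {a : M.Γ} {p : M.Q}
    {v w : List M.Γ} (hw : ∃ u, a :: w = u ++ [M.Z₀]) (h : 0 < M.δ q σ a p v) :
    ∃ u, v ++ w = u ++ [M.Z₀] := by
  obtain ⟨u, hw⟩ := hw
  rcases u with _ | ⟨b, u⟩
  · obtain ⟨rfl, rfl⟩ : a = M.Z₀ ∧ w = [] := by simpa using hw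
    obtain ⟨v', -, rfl⟩ := (M.bottom _ _ _ _ _ h).2 rfl
    exact ⟨v', by simp⟩
  · obtain ⟨rfl, rfl⟩ : a = b ∧ w = u ++ [M.Z₀] := by simpa using hw
    exact ⟨v ++ u, by simp⟩

/-- A machine without endmarkers decides with probability one. -/
theorem NoEndmarkerPPDA.accProb_add_rejProb {A : Type u} (N : NoEndmarkerPPDA A) (x : List A) :
    N.accProb x + N.rejProb x = 1 := by
  -- If symbols are left, the input is nonempty, so in the initial situation the λ-moves are blocked
  -- and reading alone has total one. The condition on the stack excludes the empty stack, whose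
  -- value is 0.
  have key : ∀ c, N.FreeHalts x c → (x = [] → c.rest = []) → (∃ u, c.stack = u ++ [N.Z₀]) →
      N.stopVal x N.Qacc c + N.stopVal x N.Qrej c = 1 := by
    intro c hc
    induction hc with
    | intro c hacc ih =>
    intro hx hst
    have hc : N.FreeHalts x c := ⟨_, hacc⟩
    obtain ⟨q, r, w⟩ := c
    obtain ⟨u, rfl : w = u ++ [N.Z₀]⟩ := hst
    obtain ⟨a, w, hw⟩ : ∃ a w, u ++ [N.Z₀] = a :: w := by cases u <;> simp
    have hbot : ∀ σ p v, 0 < N.δ q σ a p v → ∃ u', v ++ w = u' ++ [N.Z₀] :=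
      fun σ p v hp => PPDA.bottom_append ⟨u, hw.symm⟩ hp
    have hlam : ∀ p v, 0 < N.lamδ x q a p v → 0 < N.δ q none a p v := by
      intro p v hp
      unfold PPDA.lamδ at hp
      split_ifs at hp with h
      · exact absurd hp (lt_irrefl _)
      · exact hp
    rw [hw] at hc ih ⊢
    have e1 : N.lamAvg x q a (fun p v => N.stopVal x N.Qacc ⟨p, r, v ++ w⟩) +
        N.lamAvg x q a (fun p v => N.stopVal x N.Qrej ⟨p, r, v ++ w⟩) =
        N.lamAvg x q a fun _ _ => 1 := by
      rw [← PPDA.lamAvg_add]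
      exact PPDA.lamAvg_congr fun p v hp =>
        ih _ (.lam _ _ _ _ _ _ hp) hx (hbot _ _ _ (hlam _ _ hp))
    rcases r with _ | ⟨σ, r⟩
    · rw [PPDA.stopVal_nil _ hc, PPDA.stopVal_nil _ hc]
      have hq : q ∈ N.Qacc ∪ N.Qrej := by rw [N.cover]; trivial
      rcases hq with hq | hq
      · rw [if_pos hq, if_neg (Set.disjoint_left.1 N.disj hq)]
        linarith
      · rw [if_pos hq, if_neg (Set.disjoint_right.1 N.disj hq)]
        linarith
    · rw [PPDA.stopVal_cons _ hc, PPDA.stopVal_cons _ hc]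
      have e2 : N.avg q (some σ) a (fun p v => N.stopVal x N.Qacc ⟨p, r, v ++ w⟩) +
          N.avg q (some σ) a (fun p v => N.stopVal x N.Qrej ⟨p, r, v ++ w⟩) =
          N.total q (some σ) a := by
        rw [← PPDA.avg_add, ← PPDA.avg_one]
        exact PPDA.avg_congr fun p v hp => ih _ (.read _ _ _ _ _ _ _ hp)
          (fun h => absurd (hx h) (List.cons_ne_nil _ _)) (hbot _ _ _ hp)
      have e3 : N.total q (some σ) a + N.lamAvg x q a (fun _ _ => 1) = 1 := by
        have hx' : x ≠ [] := fun h => absurd (hx h) (List.cons_ne_nil _ _)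
        unfold PPDA.lamAvg
        split_ifs with h
        · rw [h.2.1, h.2.2, N.start_read, add_zero]
        · rw [PPDA.avg_one]
          exact N.prob q a (fun h' => h ⟨hx', h'⟩) σ
      linarith
  exact key _ (N.freeHalts_init x) (fun h => h) ⟨[], rfl⟩

/-! ### Machines given by finitely supported weights -/

/-- The weights `μ` are nonnegative, and positive only where `P` holds. -/
def IsWeight {α : Type*} (P : α → Prop) (μ : α →₀ ℝ) : Prop :=
  ∀ y, 0 ≤ μ y ∧ (0 < μ y → P y)

namespace IsWeight

variable {α β : Type*} {P : α → Prop} {μ ν : α →₀ ℝ}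

lemma zero : IsWeight P 0 := fun y => by simp

lemma single {y : α} {c : ℝ} (hc : 0 ≤ c) (hy : P y) : IsWeight P (Finsupp.single y c) := by
  intro z
  rw [Finsupp.single_apply]
  split_ifs with h
  · exact ⟨hc, fun _ => h ▸ hy⟩
  · simp

lemma add (hμ : IsWeight P μ) (hν : IsWeight P ν) : IsWeight P (μ + ν) := by
  intro y
  rw [Finsupp.add_apply]
  refine ⟨add_nonneg (hμ y).1 (hν y).1, fun h => ?_⟩
  rcases (hμ y).1.eq_or_lt with h0 | h0
  · exact (hν y).2 (by linarith)
  · exact (hμ y).2 h0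

lemma sum {ι : Type*} {s : Finset ι} {f : ι → α →₀ ℝ} (h : ∀ i ∈ s, IsWeight P (f i)) :
    IsWeight P (∑ i ∈ s, f i) := by
  induction s using Finset.induction_on with
  | empty => simpa using zero
  | insert i s hi ih =>
    rw [Finset.sum_insert hi]
    exact (h i (by simp)).add (ih fun j hj => h j (by simp [hj]))

lemma smul {c : ℝ} (hc : 0 ≤ c) (hμ : 0 < c → IsWeight P μ) : IsWeight P (c • μ) := by
  rcases hc.eq_or_lt with rfl | hc'
  · simpa using zero
  · intro y
    rw [Finsupp.smul_apply, smul_eq_mul]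
    exact ⟨mul_nonneg hc (hμ hc' y).1, fun h => (hμ hc' y).2 (pos_of_mul_pos_right h hc)⟩

lemma mono {P' : α → Prop} (h : IsWeight P μ) (hP : ∀ y, P y → P' y) : IsWeight P' μ :=
  fun y => ⟨(h y).1, fun hy => hP y ((h y).2 hy)⟩

lemma linearCombination {P' : β → Prop} (h : IsWeight P μ) {k : α → β →₀ ℝ}
    (hk : ∀ y, P y → IsWeight P' (k y)) :
    IsWeight P' (Finsupp.linearCombination ℝ k μ) :=
  sum fun y _ => smul (h y).1 fun hy => hk y ((h y).2 hy)

lemma linearCombination_congr (h : IsWeight P μ) {X Y : α → ℝ} (hXY : ∀ y, P y → X y = Y y) :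
    Finsupp.linearCombination ℝ X μ = Finsupp.linearCombination ℝ Y μ := by
  refine Finset.sum_congr rfl fun y _ => ?_
  rcases (h y).1.eq_or_lt with h0 | h0
  · simp [← h0]
  · simp [hXY y ((h y).2 h0)]

lemma linearCombination_mono (h : IsWeight P μ) {X Y : α → ℝ} (hXY : ∀ y, P y → X y ≤ Y y) :
    Finsupp.linearCombination ℝ X μ ≤ Finsupp.linearCombination ℝ Y μ := by
  refine Finset.sum_le_sum fun y _ => ?_
  rcases (h y).1.eq_or_lt with h0 | h0
  · simp [← h0]
  · exact mul_le_mul_of_nonneg_left (hXY y ((h y).2 h0)) (h y).1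

lemma le_linearCombination_one (h : IsWeight P μ) (y : α) :
    μ y ≤ Finsupp.linearCombination ℝ (fun _ => (1 : ℝ)) μ := by
  by_cases hy : y ∈ μ.support
  · have := Finset.single_le_sum (f := fun y => μ y • (1 : ℝ))
      (fun z _ => by simpa using (h z).1) hy
    simpa [Finsupp.linearCombination_apply, Finsupp.sum] using this
  · rw [Finsupp.notMem_support_iff.1 hy]
    exact Finset.sum_nonneg fun z _ => by simpa using (h z).1

end IsWeight

/-- The condition on the moves that keeps the bottom marker `z` at the bottom. -/
def KeepsBottom {Γ : Type*} (z a : Γ) (v : List Γ) : Prop :=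
  (a ≠ z → z ∉ v) ∧ (a = z → ∃ v', z ∉ v' ∧ v = v' ++ [z])

lemma KeepsBottom.singleton {Γ : Type*} (z a : Γ) : KeepsBottom z a [a] := by
  refine ⟨fun h => by simpa using h.symm, ?_⟩
  rintro rfl
  exact ⟨[], by simp⟩

lemma PPDA.keepsBottom {A : Type u} (M : PPDA A) {q : M.Q} {σ : Option A} {a : M.Γ} {p : M.Q}
    {v : List M.Γ} (h : 0 < M.δ q σ a p v) : KeepsBottom M.Z₀ a v := M.bottom _ _ _ _ _ h

/-- The machine whose moves have the finitely supported weights `μ`. -/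
@[reducible]
noncomputable def PPDA.ofMoves {A : Type u} [Finite A] (Q Γ : Type u) [Fintype Q] [Finite Γ]
    (μ : Q → Option A → Γ → (Q × List Γ →₀ ℝ)) (q₀ : Q) (Z₀ : Γ) (Qacc Qrej : Set Q)
    (disj : Disjoint Qacc Qrej)
    (hμ : ∀ q σ a, IsWeight (fun y => KeepsBottom Z₀ a y.2) (μ q σ a))
    (hμ1 : ∀ q σ a, Finsupp.linearCombination ℝ (fun _ => (1 : ℝ)) (μ q σ a) ≤ 1) : PPDA A where
  Q := Q
  Γ := Γ
  -- As `A` is finite, there are finitely many weights, each of finite support, so only finitely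
  -- many strings are pushed.
  Θ := insert [] (Set.finite_iUnion fun y : Q × Option A × Γ =>
    ((μ y.1 y.2.1 y.2.2).support.image Prod.snd).finite_toSet).toFinset
  nil_mem := by simp
  δ q σ a p v := μ q σ a (p, v)
  δ_mem q σ a p v := ⟨(hμ q σ a (p, v)).1,
    ((hμ q σ a).le_linearCombination_one _).trans (hμ1 q σ a)⟩
  δ_supp q σ a p v h := by
    by_contra h0
    apply h
    simp only [Finset.mem_insert, Set.Finite.mem_toFinset, Set.mem_iUnion, Finset.mem_coe,
      Finset.mem_image, Finsupp.mem_support_iff]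
    exact Or.inr ⟨(q, σ, a), (p, v), h0, rfl⟩
  q₀ := q₀
  Z₀ := Z₀
  Qacc := Qacc
  Qrej := Qrej
  disj := disj
  bottom q σ a p v h := (hμ q σ a (p, v)).2 h

/-- Turns averages over moves into linear functionals of the weights, the form in which both
simulations are computed. -/
lemma PPDA.avg_ofMoves {A : Type u} [Finite A] {Q Γ : Type u} [Fintype Q] [Finite Γ]
    {μ : Q → Option A → Γ → (Q × List Γ →₀ ℝ)} {q₀ : Q} {Z₀ : Γ} {Qacc Qrej : Set Q}
    {disj : Disjoint Qacc Qrej}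
    {hμ : ∀ q σ a, IsWeight (fun y => KeepsBottom Z₀ a y.2) (μ q σ a)}
    {hμ1 : ∀ q σ a, Finsupp.linearCombination ℝ (fun _ => (1 : ℝ)) (μ q σ a) ≤ 1}
    (q : Q) (σ : Option A) (a : Γ) (X : Q → List Γ → ℝ) :
    (ofMoves Q Γ μ q₀ Z₀ Qacc Qrej disj hμ hμ1).avg q σ a X =
      Finsupp.linearCombination ℝ (fun y => X y.1 y.2) (μ q σ a) := by
  rw [Finsupp.linearCombination_apply, Finsupp.sum]
  unfold avg
  rw [← Finset.sum_product']
  symm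
  refine Finset.sum_subset ?_ ?_
  · rintro ⟨p, v⟩ h
    refine Finset.mem_product.2 ⟨Finset.mem_univ _, ?_⟩
    by_contra h0
    exact Finsupp.mem_support_iff.1 h
      ((ofMoves Q Γ μ q₀ Z₀ Qacc Qrej disj hμ hμ1).δ_supp q σ a p v h0)
  · rintro ⟨p, v⟩ - h
    rw [Finsupp.notMem_support_iff.1 h, zero_smul]

/-! ### Adding endmarkers -/

/-- The weights of the moves of `N`, with `c` applied to the states reached. -/
noncomputable def PPDA.moves {A : Type u} (N : PPDA A) {Q' : Type*} (c : N.Q → Q') (q : N.Q)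
    (σ : Option A) (a : N.Γ) : Q' × List N.Γ →₀ ℝ :=
  ∑ p, ∑ v ∈ N.Θ, Finsupp.single (c p, v) (N.δ q σ a p v)

lemma PPDA.linearCombination_moves {A : Type u} (N : PPDA A) {Q' : Type*} (c : N.Q → Q')
    (q : N.Q) (σ : Option A) (a : N.Γ) (X : Q' × List N.Γ → ℝ) :
    Finsupp.linearCombination ℝ X (N.moves c q σ a) = N.avg q σ a fun p v => X (c p, v) := by
  simp [moves, avg]

lemma PPDA.isWeight_moves {A : Type u} (N : PPDA A) {Q' : Type*} (c : N.Q → Q')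
    (q : N.Q) (σ : Option A) (a : N.Γ) :
    IsWeight (fun y => ∃ p, y.1 = c p ∧ 0 < N.δ q σ a p y.2) (N.moves c q σ a) := by
  refine IsWeight.sum fun p _ => IsWeight.sum fun v _ => ?_
  rcases (PPDA.δ_nonneg q σ a p v).eq_or_lt with h0 | h0
  · rw [← h0, Finsupp.single_zero]
    exact IsWeight.zero
  · exact IsWeight.single h0.le ⟨p, rfl, h0⟩

/-- The tape content after the left endmarker. -/
def Marked.rest {A : Type u} (r : List A) : List (Marked A) := r.map .sym ++ [.right]

lemma eq_of_single_pos {α : Type*} {y z : α} {c : ℝ} (h : 0 < Finsupp.single y c z) : z = y := by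
  by_contra hne
  rw [Finsupp.single_eq_of_ne hne] at h
  exact lt_irrefl _ h

/-- The states of the machine with endmarkers that simulates a machine with states `Q`: before and
after the left endmarker, the simulation on a nonempty input, the simulation on the empty input
after the right endmarker, and the two results. -/
inductive MarkedState (Q : Type u) : Type u
  | start : MarkedState Q
  | fresh : MarkedState Q
  | run : Q → MarkedState Q
  | after : Q → MarkedState Q
  | res : Bool → MarkedState Q

namespace MarkedState

instance {Q : Type u} [Finite Q] : Finite (MarkedState Q) := by
  refine Finite.of_injective (β := (Bool ⊕ Bool) ⊕ (Q ⊕ Q)) (fun s => match s with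
    | start => .inl (.inl true)
    | fresh => .inl (.inl false)
    | res b => .inl (.inr b)
    | run q => .inr (.inl q)
    | after q => .inr (.inr q)) ?_
  intro s t h
  cases s <;> cases t <;> simp_all

noncomputable instance {Q : Type u} [Finite Q] : Fintype (MarkedState Q) := Fintype.ofFinite _

end MarkedState

namespace NoEndmarkerPPDA

open MarkedState

variable {A : Type u} (N : NoEndmarkerPPDA A)

/-- The `λ`-moves on a nonempty input. -/
noncomputable def runLam (q : N.Q) (a : N.Γ) : MarkedState N.Q × List N.Γ →₀ ℝ :=
  if q = N.q₀ ∧ a = N.Z₀ then 0 else N.moves run q none a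

/-- The moves of the simulation with endmarkers. -/
noncomputable def markedMoves :
    MarkedState N.Q → Option (Marked A) → N.Γ → (MarkedState N.Q × List N.Γ →₀ ℝ)
  | start, none, _ => 0
  | start, some _, a => Finsupp.single (fresh, [a]) 1
  | fresh, none, _ => 0
  -- `¢` does not occur here; the move only brings the total to one.
  | fresh, some .left, a => Finsupp.single (res false, [a]) 1
  -- `$` directly after `¢` reveals the empty input.
  | fresh, some .right, a => Finsupp.single (after N.q₀, [a]) 1
  | fresh, some (.sym σ), a =>
      if a = N.Z₀ then N.moves run N.q₀ (some σ) a else Finsupp.single (res false, [a]) 1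
  | run q, none, a => N.runLam q a
  | run q, some (.sym σ), a => N.moves run q (some σ) a
  | run q, some .left, a => Finsupp.single (res false, [a])
      (1 - Finsupp.linearCombination ℝ (fun _ => (1 : ℝ)) (N.runLam q a))
  -- The probability left over by the λ-moves is that of stopping here.
  | run q, some .right, a => Finsupp.single (res (decide (q ∈ N.Qacc)), [a])
      (1 - Finsupp.linearCombination ℝ (fun _ => (1 : ℝ)) (N.runLam q a))
  | after q, none, a => N.moves after q none a +
      Finsupp.single (res (decide (q ∈ N.Qacc)), [a]) (1 - N.total q none a)
  | after _, some _, _ => 0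
  | res _, _, _ => 0

variable {N}

lemma linearCombination_runLam {x : List A} (hx : x ≠ []) (q : N.Q) (a : N.Γ)
    (X : MarkedState N.Q × List N.Γ → ℝ) :
    Finsupp.linearCombination ℝ X (N.runLam q a) = N.lamAvg x q a fun p v => X (run p, v) := by
  unfold runLam PPDA.lamAvg
  by_cases h : q = N.q₀ ∧ a = N.Z₀
  · rw [if_pos h, if_pos ⟨hx, h⟩, map_zero]
  · rw [if_neg h, if_neg fun h' => h h'.2, N.linearCombination_moves]

lemma isWeight_runLam (x : List A) (q : N.Q) (a : N.Γ) :
    IsWeight (fun y => ∃ p, y.1 = run p ∧ 0 < N.lamδ x q a p y.2) (N.runLam q a) := by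
  unfold runLam PPDA.lamδ
  by_cases h : q = N.q₀ ∧ a = N.Z₀
  · rw [if_pos h]
    exact IsWeight.zero
  · simp only [if_neg h, if_neg fun h' : x ≠ [] ∧ q = N.q₀ ∧ a = N.Z₀ => h h'.2]
    exact N.isWeight_moves _ _ _ _

lemma isWeight_runLam_keepsBottom (q : N.Q) (a : N.Γ) :
    IsWeight (fun y => KeepsBottom N.Z₀ a y.2) (N.runLam q a) := by
  unfold runLam
  split_ifs
  · exact IsWeight.zero
  · exact (N.isWeight_moves _ _ _ _).mono fun y ⟨p, _, h⟩ => N.keepsBottom h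

lemma linearCombination_runLam_one (q : N.Q) (a : N.Γ) :
    Finsupp.linearCombination ℝ (fun _ => (1 : ℝ)) (N.runLam q a) =
      if q = N.q₀ ∧ a = N.Z₀ then 0 else N.total q none a := by
  unfold runLam
  split_ifs
  · rw [map_zero]
  · rw [N.linearCombination_moves, PPDA.avg_one]

lemma linearCombination_runLam_one_le [Nonempty A] (q : N.Q) (a : N.Γ) :
    Finsupp.linearCombination ℝ (fun _ => (1 : ℝ)) (N.runLam q a) ≤ 1 := by
  rw [linearCombination_runLam_one]
  split_ifs
  · exact zero_le_one
  · exact N.total_none_le_one q a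

lemma total_some_add_runLam (q : N.Q) (a : N.Γ) (σ : A) : N.total q (some σ) a +
    Finsupp.linearCombination ℝ (fun _ => (1 : ℝ)) (N.runLam q a) = 1 := by
  rw [linearCombination_runLam_one]
  split_ifs with h
  · rw [h.1, h.2, N.start_read, add_zero]
  · exact N.prob q a h σ

lemma isWeight_markedMoves [Nonempty A] (s : MarkedState N.Q) (σ : Option (Marked A)) (a : N.Γ) :
    IsWeight (fun y => KeepsBottom N.Z₀ a y.2) (N.markedMoves s σ a) := by
  have hs : ∀ (t : MarkedState N.Q) (c : ℝ), 0 ≤ c → IsWeight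
      (fun y : MarkedState N.Q × List N.Γ => KeepsBottom N.Z₀ a y.2) (Finsupp.single (t, [a]) c) :=
    fun t c hc => IsWeight.single hc (KeepsBottom.singleton _ _)
  have hm : ∀ (c : N.Q → MarkedState N.Q) q σ, IsWeight
      (fun y : MarkedState N.Q × List N.Γ => KeepsBottom N.Z₀ a y.2) (N.moves c q σ a) :=
    fun c q σ => (N.isWeight_moves _ _ _ _).mono fun y ⟨p, _, h⟩ => N.keepsBottom h
  have h1 := fun q => sub_nonneg.2 (N.total_none_le_one q a)
  have h2 := fun q => sub_nonneg.2 (linearCombination_runLam_one_le (N := N) q a)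
  rcases s with _ | _ | q | q | b <;> rcases σ with _ | _ | σ | _ <;> simp only [markedMoves] <;>
    first
    | exact IsWeight.zero
    | exact hs _ _ zero_le_one
    | exact hs _ _ (h2 _)
    | exact hm _ _ _
    | exact isWeight_runLam_keepsBottom _ _
    | exact (hm _ _ _).add (hs _ _ (h1 _))
    | skip
  split_ifs
  · exact hm _ _ _
  · exact hs _ _ zero_le_one

lemma linearCombination_one_markedMoves (s : MarkedState N.Q) (hs : ∀ b, s ≠ res b)
    (σ : Marked A) (a : N.Γ) :
    Finsupp.linearCombination ℝ (fun _ => (1 : ℝ)) (N.markedMoves s (some σ) a) +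
      Finsupp.linearCombination ℝ (fun _ => (1 : ℝ)) (N.markedMoves s none a) = 1 := by
  rcases s with _ | _ | q | q | b <;> rcases σ with _ | σ | _ <;>
    simp only [markedMoves, map_zero, Finsupp.linearCombination_single, smul_eq_mul, mul_one,
      add_zero, zero_add, map_add, N.linearCombination_moves, PPDA.avg_one,
      add_sub_cancel, sub_add_cancel, total_some_add_runLam]
  · split_ifs with h
    · rw [h, N.linearCombination_moves, PPDA.avg_one, N.start_read]
    · simp
  all_goals exact absurd rfl (hs b)

lemma linearCombination_one_markedMoves_le [Nonempty A] (s : MarkedState N.Q)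
    (σ : Option (Marked A)) (a : N.Γ) :
    Finsupp.linearCombination ℝ (fun _ => (1 : ℝ)) (N.markedMoves s σ a) ≤ 1 := by
  by_cases hs : ∀ b, s ≠ res b
  · have h0 : ∀ σ, 0 ≤ Finsupp.linearCombination ℝ (fun _ => (1 : ℝ)) (N.markedMoves s σ a) :=
      fun σ => Finset.sum_nonneg fun y _ => by simpa using (isWeight_markedMoves s σ a y).1
    rcases σ with _ | σ
    · have := linearCombination_one_markedMoves s hs .left a
      linarith [h0 (some .left)]
    · have := linearCombination_one_markedMoves s hs σ a
      linarith [h0 none]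
  · push Not at hs
    obtain ⟨b, rfl⟩ := hs
    simp [markedMoves]

lemma lamδ_nil (q : N.Q) (a : N.Γ) (p : N.Q) (v : List N.Γ) :
    N.lamδ [] q a p v = N.δ q none a p v := by
  simp [PPDA.lamδ]

lemma lamAvg_nil (q : N.Q) (a : N.Γ) (X : N.Q → List N.Γ → ℝ) :
    N.lamAvg [] q a X = N.avg q none a X := by
  simp [PPDA.lamAvg]

/-- What is left on the tape in a reachable configuration. -/
def MarkedInv : MarkedState N.Q → List (Marked A) → Prop
  | start, t => ∃ r : List A, t = .left :: Marked.rest r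
  | fresh, t => ∃ r : List A, t = Marked.rest r
  | run _, t => ∃ r : List A, t = Marked.rest r
  | after _, _ => True
  | res _, _ => True

lemma exists_rest_of_cons {t : List (Marked A)} {σ : A}
    (h : ∃ r : List A, Marked.sym σ :: t = Marked.rest r) : ∃ r : List A, t = Marked.rest r := by
  obtain ⟨r, hr⟩ := h
  rcases r with _ | ⟨τ, r⟩
  · simp [Marked.rest] at hr
  · exact ⟨r, (List.cons.inj hr).2⟩

lemma isWeight_after [Nonempty A] (q : N.Q) (a : N.Γ) :
    IsWeight (fun y => (∃ p, y.1 = after p ∧ 0 < N.δ q none a p y.2) ∨ ∃ b, y.1 = res b)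
      (N.markedMoves (after q) none a) :=
  ((N.isWeight_moves _ _ _ _).mono fun _ hy => .inl hy).add
    (IsWeight.single (sub_nonneg.2 (N.total_none_le_one q a)) (.inr ⟨_, rfl⟩))

lemma MarkedInv.read {s : MarkedState N.Q} {σ : Marked A} {t : List (Marked A)} {a : N.Γ}
    {p : MarkedState N.Q} {v : List N.Γ} (h : MarkedInv s (σ :: t))
    (hp : 0 < N.markedMoves s (some σ) a (p, v)) : MarkedInv p t := by
  rcases s with _ | _ | q | q | b
  · obtain ⟨rfl, rfl⟩ := Prod.ext_iff.1 (eq_of_single_pos hp)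
    obtain ⟨r, hr⟩ := h
    exact ⟨r, (List.cons.inj hr).2⟩
  · rcases σ with _ | σ | _
    · obtain ⟨rfl, rfl⟩ := Prod.ext_iff.1 (eq_of_single_pos hp)
      trivial
    · rw [markedMoves] at hp
      split_ifs at hp
      · obtain ⟨p, rfl, -⟩ := (N.isWeight_moves run _ _ _ (p, v)).2 hp
        exact exists_rest_of_cons h
      · obtain ⟨rfl, rfl⟩ := Prod.ext_iff.1 (eq_of_single_pos hp)
        trivial
    · obtain ⟨rfl, rfl⟩ := Prod.ext_iff.1 (eq_of_single_pos hp)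
      trivial
  · rcases σ with _ | σ | _
    · obtain ⟨rfl, rfl⟩ := Prod.ext_iff.1 (eq_of_single_pos hp)
      trivial
    · obtain ⟨p, rfl, -⟩ := (N.isWeight_moves run _ _ _ (p, v)).2 hp
      exact exists_rest_of_cons h
    · obtain ⟨rfl, rfl⟩ := Prod.ext_iff.1 (eq_of_single_pos hp)
      trivial
  · exact absurd hp (lt_irrefl _)
  · exact absurd hp (lt_irrefl _)

lemma MarkedInv.lam [Nonempty A] {s : MarkedState N.Q} {t : List (Marked A)} {a : N.Γ}
    {p : MarkedState N.Q} {v : List N.Γ} (h : MarkedInv s t)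
    (hp : 0 < N.markedMoves s none a (p, v)) : MarkedInv p t := by
  rcases s with _ | _ | q | q | b
  · exact absurd hp (lt_irrefl _)
  · exact absurd hp (lt_irrefl _)
  · obtain ⟨p, rfl, -⟩ := (isWeight_runLam [] q a (p, v)).2 hp
    exact h
  · rcases (isWeight_after q a (p, v)).2 hp with ⟨p, rfl, hp⟩ | ⟨b, rfl⟩ <;> trivial
  · exact absurd hp (lt_irrefl _)

instance [Finite A] : Finite (Marked A) := by
  refine Finite.of_injective (β := Bool ⊕ A) (fun s => match s with
    | .left => .inl true
    | .right => .inl false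
    | .sym a => .inr a) ?_
  intro s t h
  cases s <;> cases t <;> simp_all

variable (N)

/-- The simulation with endmarkers. -/
@[reducible]
noncomputable def markedPPDA [Finite A] [Nonempty A] : PPDA (Marked A) :=
  PPDA.ofMoves (MarkedState N.Q) N.Γ N.markedMoves start N.Z₀ {res true} {res false} (by simp)
    isWeight_markedMoves linearCombination_one_markedMoves_le

variable {N} [Finite A] [Nonempty A]

lemma avg_markedPPDA (s : MarkedState N.Q) (σ : Option (Marked A)) (a : N.Γ)
    (X : MarkedState N.Q → List N.Γ → ℝ) :
    N.markedPPDA.avg s σ a X =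
      Finsupp.linearCombination ℝ (fun y => X y.1 y.2) (N.markedMoves s σ a) :=
  PPDA.avg_ofMoves ..

lemma total_markedPPDA (s : MarkedState N.Q) (σ : Option (Marked A)) (a : N.Γ) :
    N.markedPPDA.total s σ a =
      Finsupp.linearCombination ℝ (fun _ => (1 : ℝ)) (N.markedMoves s σ a) := by
  rw [← PPDA.avg_one, avg_markedPPDA]

lemma mem_Qhalt_markedPPDA {s : MarkedState N.Q} :
    s ∈ N.markedPPDA.Qhalt ↔ ∃ b, s = res b := by
  change s ∈ ({res true} ∪ {res false} : Set (MarkedState N.Q)) ↔ _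
  simp

lemma notMem_Qhalt_markedPPDA {s : MarkedState N.Q} (h : ∀ b, s ≠ res b) :
    s ∉ N.markedPPDA.Qhalt := fun hs => by
  obtain ⟨b, hb⟩ := mem_Qhalt_markedPPDA.1 hs
  exact h b hb

/-! ### Termination of the simulation with endmarkers -/

lemma halts_res (b : Bool) (t : List (Marked A)) (w : List N.Γ) :
    N.markedPPDA.Halts ⟨res b, t, w⟩ := by
  refine ⟨_, fun c h => ?_⟩
  cases h with
  | read _ _ _ _ _ _ _ hq => exact absurd (mem_Qhalt_markedPPDA.2 ⟨b, rfl⟩) hq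
  | lam _ _ _ _ _ _ hq => exact absurd (mem_Qhalt_markedPPDA.2 ⟨b, rfl⟩) hq

/-- A simulated move is a move of `N`, and reading `$` halts at once, so accessibility is inherited.
-/
lemma halts_run {x : List A} {c : N.Config} (hc : N.FreeHalts x c) :
    N.markedPPDA.Halts ⟨run c.state, Marked.rest c.rest, c.stack⟩ := by
  induction hc with
  | intro c hacc ih =>
  obtain ⟨q, r, w⟩ := c
  refine ⟨_, fun c' h => ?_⟩
  have hlam : ∀ a w' p v, w = a :: w' → 0 < N.markedMoves (run q) none a (p, v) →
      N.markedPPDA.Halts ⟨p, Marked.rest r, v ++ w'⟩ := by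
    rintro a w' p v rfl hp
    obtain ⟨p, rfl, hp⟩ := (isWeight_runLam x q a (p, v)).2 hp
    exact ih _ (.lam _ _ _ _ _ _ hp)
  rcases r with _ | ⟨σ, r⟩
  · change N.markedPPDA.Step ⟨run q, [.right], w⟩ c' at h
    cases h with
    | read _ _ _ _ _ p v _ hp =>
      obtain ⟨rfl, rfl⟩ := Prod.ext_iff.1 (eq_of_single_pos hp)
      exact halts_res _ _ _
    | lam _ _ _ _ p v _ hp => exact hlam _ _ _ _ rfl hp
  · change N.markedPPDA.Step ⟨run q, .sym σ :: Marked.rest r, w⟩ c' at h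
    cases h with
    | read _ _ _ a _ p v _ hp =>
      obtain ⟨p, rfl, hp⟩ := (N.isWeight_moves run q (some σ) a (p, v)).2 hp
      exact ih _ (.read _ _ _ _ _ _ _ hp)
    | lam _ _ _ _ p v _ hp => exact hlam _ _ _ _ rfl hp

lemma halts_after {c : N.Config} (hc : N.FreeHalts [] c) :
    N.markedPPDA.Halts ⟨after c.state, [], c.stack⟩ := by
  induction hc with
  | intro c hacc ih =>
  obtain ⟨q, r, w⟩ := c
  refine ⟨_, fun c' h => ?_⟩
  cases h with
  | lam _ _ a w p v _ hp =>
    rcases (isWeight_after q a (p, v)).2 hp with ⟨p, rfl, hp⟩ | ⟨b, rfl⟩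
    · exact ih _ (.lam _ _ _ _ _ _ (by rwa [lamδ_nil]))
    · exact halts_res _ _ _

lemma halts_fresh (x : List A) : N.markedPPDA.Halts ⟨fresh, Marked.rest x, [N.Z₀]⟩ := by
  have hN := N.freeHalts_init x
  refine ⟨_, fun c' h => ?_⟩
  rcases x with _ | ⟨σ, r⟩
  · change N.markedPPDA.Step ⟨fresh, [.right], [N.Z₀]⟩ c' at h
    cases h with
    | read _ _ _ _ _ p v _ hp =>
      obtain ⟨rfl, rfl⟩ := Prod.ext_iff.1 (eq_of_single_pos hp)
      exact halts_after hN
    | lam _ _ _ _ p v _ hp => exact absurd hp (lt_irrefl _)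
  · change N.markedPPDA.Step ⟨fresh, .sym σ :: Marked.rest r, [N.Z₀]⟩ c' at h
    cases h with
    | read _ _ _ _ _ p v _ hp =>
      change 0 < N.markedMoves fresh (some (.sym σ)) N.Z₀ (p, v) at hp
      rw [markedMoves, if_pos rfl] at hp
      obtain ⟨p, rfl, hp⟩ := (N.isWeight_moves run _ _ _ (p, v)).2 hp
      exact halts_run (hN.step (.read _ _ _ _ _ _ _ hp))
    | lam _ _ _ _ p v _ hp => exact absurd hp (lt_irrefl _)

lemma halts_start (x : List A) : N.markedPPDA.Halts (N.markedPPDA.init (Marked.tape x)) := by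
  refine ⟨_, fun c' h => ?_⟩
  change N.markedPPDA.Step ⟨start, .left :: Marked.rest x, [N.Z₀]⟩ c' at h
  cases h with
  | read _ _ _ _ _ p v _ hp =>
    obtain ⟨rfl, rfl⟩ := Prod.ext_iff.1 (eq_of_single_pos hp)
    exact halts_fresh x
  | lam _ _ _ _ p v _ hp => exact absurd hp (lt_irrefl _)

lemma markedInv_of_reachable {x : List A} {c : N.markedPPDA.Config}
    (h : Relation.ReflTransGen N.markedPPDA.Step (N.markedPPDA.init (Marked.tape x)) c) :
    MarkedInv c.state c.rest := by
  induction h with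
  | refl => exact ⟨x, rfl⟩
  | tail _ hs ih =>
    cases hs with
    | read _ _ _ _ _ _ _ _ hp => exact ih.read hp
    | lam _ _ _ _ _ _ _ hp => exact ih.lam hp

variable (N)

/-- A machine without endmarkers as a machine with endmarkers. -/
noncomputable def toEndmarker : EndmarkerPPDA A where
  toPPDA := N.markedPPDA
  prob s hs σ a := by
    rw [total_markedPPDA, total_markedPPDA]
    exact linearCombination_one_markedMoves s (fun b h => hs (mem_Qhalt_markedPPDA.2 ⟨b, h⟩)) σ a
  start _ := by
    change N.markedPPDA.total start none N.Z₀ = 0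
    rw [total_markedPPDA]
    simp [markedMoves]
  finite_paths x h := not_acc_iff_exists_descending_chain.2 h (halts_start x)
  not_stuck x s a w h hs := by
    rw [total_markedPPDA]
    have hinv := markedInv_of_reachable h
    rcases s with _ | _ | q | q | b
    -- By the invariant `$` is still unread in the states `start`, `fresh` and `run`, which leaves
    -- only `after`, whose λ-moves are completed to total one.
    · obtain ⟨r, hr⟩ := hinv
      simp at hr
    · obtain ⟨r, hr⟩ := hinv
      simp [Marked.rest] at hr
    · obtain ⟨r, hr⟩ := hinv
      simp [Marked.rest] at hr
    · simp [markedMoves, PPDA.linearCombination_moves, PPDA.avg_one]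
    · exact absurd (mem_Qhalt_markedPPDA.2 ⟨b, rfl⟩) hs

variable {N}

/-! ### Acceptance and rejection by the simulation with endmarkers -/

/-- The sets `S` and `T` are kept general so that acceptance and rejection are treated together. -/
lemma haltVal_run {x : List A} (hx : x ≠ []) {S : Set N.Q} {T : Set (MarkedState N.Q)}
    (hST : ∀ q, res (decide (q ∈ N.Qacc)) ∈ T ↔ q ∈ S) {c : N.Config} (hc : N.FreeHalts x c) :
    N.markedPPDA.haltVal T ⟨run c.state, Marked.rest c.rest, c.stack⟩ = N.stopVal x S c := by
  induction hc with
  | intro c hacc ih =>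
  have hc : N.FreeHalts x c := ⟨_, hacc⟩
  have hH := halts_run hc
  obtain ⟨q, r, w⟩ := c
  have hq : run q ∉ N.markedPPDA.Qhalt := notMem_Qhalt_markedPPDA (by simp)
  rcases w with _ | ⟨a, w⟩
  · rw [PPDA.stopVal_empty]
    exact PPDA.haltVal_empty hq _
  have hlam : N.markedPPDA.avg (run q) none a
        (fun p v => N.markedPPDA.haltVal T ⟨p, Marked.rest r, v ++ w⟩) =
      N.lamAvg x q a fun p v => N.stopVal x S ⟨p, r, v ++ w⟩ := by
    rw [avg_markedPPDA]
    refine (linearCombination_runLam hx ..).trans ?_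
    exact PPDA.lamAvg_congr fun p v hp => ih _ (.lam _ _ _ _ _ _ hp)
  rcases r with _ | ⟨σ, r⟩
  · refine (PPDA.haltVal_cons hq hH).trans ?_
    rw [PPDA.stopVal_nil _ hc, add_comm]
    refine congrArg₂ _ ?_ hlam
    rw [avg_markedPPDA, markedMoves, Finsupp.linearCombination_single,
      linearCombination_runLam hx]
    rw [PPDA.haltVal_of_mem (mem_Qhalt_markedPPDA.2 ⟨_, rfl⟩)]
    simp only [hST]
    split_ifs <;> simp
  · refine (PPDA.haltVal_cons hq hH).trans ?_
    rw [PPDA.stopVal_cons _ hc]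
    refine congrArg₂ _ hlam ?_
    rw [avg_markedPPDA, markedMoves, N.linearCombination_moves]
    exact PPDA.avg_congr fun p v hp => ih _ (.read _ _ _ _ _ _ _ hp)

lemma haltVal_after {S : Set N.Q} {T : Set (MarkedState N.Q)}
    (hST : ∀ q, res (decide (q ∈ N.Qacc)) ∈ T ↔ q ∈ S) {c : N.Config} (hc : N.FreeHalts [] c)
    (hr : c.rest = []) :
    N.markedPPDA.haltVal T ⟨after c.state, [], c.stack⟩ = N.stopVal [] S c := by
  induction hc with
  | intro c hacc ih =>
  have hc : N.FreeHalts [] c := ⟨_, hacc⟩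
  have hH := halts_after hc
  obtain ⟨q, r, w⟩ := c
  obtain rfl : r = [] := hr
  have hq : after q ∉ N.markedPPDA.Qhalt := notMem_Qhalt_markedPPDA (by simp)
  rcases w with _ | ⟨a, w⟩
  · rw [PPDA.stopVal_empty]
    exact PPDA.haltVal_empty hq _
  refine (PPDA.haltVal_nil hq hH).trans ?_
  rw [PPDA.stopVal_nil _ hc, add_comm, avg_markedPPDA, markedMoves, map_add]
  refine congrArg₂ _ ?_ ?_
  · rw [N.linearCombination_moves, lamAvg_nil]
    exact PPDA.avg_congr fun p v hp => ih _ (.lam _ _ _ _ _ _ (by rwa [lamδ_nil])) rfl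
  · rw [Finsupp.linearCombination_single, lamAvg_nil, PPDA.avg_one,
      PPDA.haltVal_of_mem (mem_Qhalt_markedPPDA.2 ⟨_, rfl⟩)]
    simp only [hST]
    split_ifs <;> simp

lemma haltVal_fresh {S : Set N.Q} {T : Set (MarkedState N.Q)}
    (hST : ∀ q, res (decide (q ∈ N.Qacc)) ∈ T ↔ q ∈ S) (x : List A) :
    N.markedPPDA.haltVal T ⟨fresh, Marked.rest x, [N.Z₀]⟩ = N.stopVal x S (N.init x) := by
  have hq : fresh ∉ N.markedPPDA.Qhalt := notMem_Qhalt_markedPPDA (by simp)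
  have hN := N.freeHalts_init x
  have hH := halts_fresh (N := N) x
  rcases x with _ | ⟨σ, r⟩
  · refine (PPDA.haltVal_cons hq hH).trans ?_
    rw [avg_markedPPDA, avg_markedPPDA, markedMoves, markedMoves, map_zero, zero_add,
      Finsupp.linearCombination_single, one_smul]
    exact haltVal_after hST hN rfl
  · refine (PPDA.haltVal_cons hq hH).trans ?_
    rw [PPDA.init, PPDA.stopVal_cons _ hN]
    refine congrArg₂ _ ?_ ?_
    · rw [avg_markedPPDA, markedMoves, map_zero, PPDA.lamAvg, if_pos (by simp)]
    · rw [avg_markedPPDA, markedMoves, if_pos rfl, N.linearCombination_moves]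
      exact PPDA.avg_congr fun p v hp =>
        haltVal_run (List.cons_ne_nil σ r) hST (hN.step (.read _ _ _ _ _ _ _ hp))

lemma haltVal_start {S : Set N.Q} {T : Set (MarkedState N.Q)}
    (hST : ∀ q, res (decide (q ∈ N.Qacc)) ∈ T ↔ q ∈ S) (x : List A) :
    N.markedPPDA.haltVal T (N.markedPPDA.init (Marked.tape x)) = N.stopVal x S (N.init x) := by
  have hq : start ∉ N.markedPPDA.Qhalt := notMem_Qhalt_markedPPDA (by simp)
  refine (PPDA.haltVal_cons hq (halts_start x)).trans ?_
  rw [avg_markedPPDA, avg_markedPPDA, markedMoves, markedMoves, map_zero, zero_add,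
    Finsupp.linearCombination_single, one_smul]
  exact haltVal_fresh hST x

lemma accProb_toEndmarker (x : List A) : N.toEndmarker.accProb x = N.accProb x :=
  haltVal_start (T := {res true}) (fun q => by simp) x

lemma rejProb_toEndmarker (x : List A) : N.toEndmarker.rejProb x = N.rejProb x := by
  refine haltVal_start (T := {res false}) (fun q => ?_) x
  have hq : q ∈ N.Qacc ∪ N.Qrej := by rw [N.cover]; trivial
  rcases hq with hq | hq
  · simp [hq, Set.disjoint_left.1 N.disj hq]
  · simp [hq, Set.disjoint_right.1 N.disj hq]

end NoEndmarkerPPDA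

/-! ### Popping a stack segment -/

lemma linearCombination_add_fun {α : Type*} (μ : α →₀ ℝ) (X Y : α → ℝ) :
    Finsupp.linearCombination ℝ (fun y => X y + Y y) μ =
      Finsupp.linearCombination ℝ X μ + Finsupp.linearCombination ℝ Y μ := by
  simp [Finsupp.linearCombination_apply, Finsupp.sum, mul_add, Finset.sum_add_distrib]

lemma linearCombination_const {α : Type*} {μ : α →₀ ℝ}
    (hμ : Finsupp.linearCombination ℝ (fun _ => (1 : ℝ)) μ = 1) (c : ℝ) :
    Finsupp.linearCombination ℝ (fun _ => c) μ = c := by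
  simp only [Finsupp.linearCombination_apply, Finsupp.sum, smul_eq_mul, mul_one] at hμ ⊢
  rw [← Finset.sum_mul, hμ, one_mul]

/-- The number `1` or `0`, according to a truth value. -/
def Bool.toReal (b : Bool) : ℝ := if b then 1 else 0

lemma Bool.toReal_nonneg (b : Bool) : 0 ≤ b.toReal := by
  cases b <;> simp [Bool.toReal]

lemma Bool.toReal_le_one (b : Bool) : b.toReal ≤ 1 := by
  cases b <;> simp [Bool.toReal]

namespace PPDA

variable {A : Type u} (M : PPDA A)

/-- Whether a state is accepting. -/
noncomputable def accepting (q : M.Q) : Bool := decide (q ∈ M.Qacc)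

/-- The probability that, with no input left, exactly `n` moves are made until either a halting
state is entered, which is accepting, or the stack segment `u` has been popped, in a nonhalting
state `p` for which `g p` is true. -/
noncomputable def popProb (g : M.Q → Bool) : ℕ → M.Q → List M.Γ → ℝ
  | 0, q, u => if q ∈ M.Qhalt then (M.accepting q).toReal else if u = [] then (g q).toReal else 0
  | _ + 1, _, [] => 0
  | n + 1, q, a :: u => if q ∈ M.Qhalt then 0 else M.avg q none a fun p v => popProb g n p (v ++ u)

/-- The probability that, with no input left, either a halting state is entered, which is
accepting, or the stack segment `u` is popped, in a nonhalting state `p` for which `g p` is true. -/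
noncomputable def popVal (g : M.Q → Bool) (q : M.Q) (u : List M.Γ) : ℝ := ∑' n, M.popProb g n q u

variable {M}

lemma popProb_nonneg (g : M.Q → Bool) (n : ℕ) (q : M.Q) (u : List M.Γ) :
    0 ≤ M.popProb g n q u := by
  induction n generalizing q u with
  | zero =>
    unfold popProb
    split_ifs
    · exact Bool.toReal_nonneg _
    · exact Bool.toReal_nonneg _
    · exact le_rfl
  | succ n ih =>
    rcases u with _ | ⟨a, u⟩
    · exact le_rfl
    · unfold popProb
      split_ifs
      · exact le_rfl
      · exact avg_nonneg fun p v => ih _ _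

/-- Outcomes after different numbers of moves are disjoint. A bound on partial sums is used in place
of well-founded induction, because a segment started in an arbitrary state may have infinite runs.
-/
lemma sum_range_popProb_le_one (hM : ∀ q ∉ M.Qhalt, ∀ a, M.total q none a ≤ 1) (g : M.Q → Bool)
    (n : ℕ) (q : M.Q) (u : List M.Γ) : ∑ k ∈ Finset.range n, M.popProb g k q u ≤ 1 := by
  induction n generalizing q u with
  | zero => simp
  | succ n ih =>
    rw [Finset.sum_range_succ']
    by_cases hq : q ∈ M.Qhalt
    · cases u <;> simp [popProb, hq, Bool.toReal_le_one]
    · rcases u with _ | ⟨a, u⟩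
      · simp [popProb, hq, Bool.toReal_le_one]
      · simp only [popProb, hq, if_false, reduceCtorEq, add_zero]
        rw [← avg_sum]
        refine le_trans (avg_mono fun p v => ih p (v ++ u)) ?_
        rw [avg_one]
        exact hM q hq a

lemma popVal_nonneg (g : M.Q → Bool) (q : M.Q) (u : List M.Γ) : 0 ≤ M.popVal g q u :=
  tsum_nonneg fun n => popProb_nonneg g n q u

lemma popVal_le_one (hM : ∀ q ∉ M.Qhalt, ∀ a, M.total q none a ≤ 1) (g : M.Q → Bool)
    (q : M.Q) (u : List M.Γ) : M.popVal g q u ≤ 1 :=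
  Real.tsum_le_of_sum_range_le (fun n => popProb_nonneg g n q u)
    fun n => sum_range_popProb_le_one hM g n q u

lemma summable_popProb (hM : ∀ q ∉ M.Qhalt, ∀ a, M.total q none a ≤ 1) (g : M.Q → Bool)
    (q : M.Q) (u : List M.Γ) : Summable fun n => M.popProb g n q u :=
  summable_of_sum_range_le (fun n => popProb_nonneg g n q u)
    fun n => sum_range_popProb_le_one hM g n q u

lemma popVal_of_mem (g : M.Q → Bool) {q : M.Q} (hq : q ∈ M.Qhalt) (u : List M.Γ) :
    M.popVal g q u = (M.accepting q).toReal := by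
  rw [popVal, tsum_eq_single 0]
  · simp [popProb, hq]
  · rintro (_ | n) hn
    · exact absurd rfl hn
    · cases u <;> simp [popProb, hq]

lemma popVal_nil (g : M.Q → Bool) {q : M.Q} (hq : q ∉ M.Qhalt) :
    M.popVal g q [] = (g q).toReal := by
  rw [popVal, tsum_eq_single 0]
  · simp [popProb, hq]
  · rintro (_ | n) hn
    · exact absurd rfl hn
    · simp [popProb]

lemma popVal_cons (hM : ∀ q ∉ M.Qhalt, ∀ a, M.total q none a ≤ 1) (g : M.Q → Bool) {q : M.Q}
    (hq : q ∉ M.Qhalt) (a : M.Γ) (u : List M.Γ) :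
    M.popVal g q (a :: u) = M.avg q none a fun p v => M.popVal g p (v ++ u) := by
  rw [popVal, (summable_popProb hM g q _).tsum_eq_zero_add]
  simp only [popProb, hq, if_false, reduceCtorEq, zero_add]
  exact (hasSum_avg fun p v _ => summable_popProb hM g p _).tsum_eq

/-- If `g` is random, with the acceptance probabilities of the stack `w` as its means, then the
values of popping `u` average to the acceptance probability of the stack `u ++ w`. -/
lemma linearCombination_popVal (hM : ∀ q ∉ M.Qhalt, ∀ a, M.total q none a ≤ 1) {α : Type*}
    {μ : α →₀ ℝ} (hμ : Finsupp.linearCombination ℝ (fun _ => (1 : ℝ)) μ = 1)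
    (g : α → M.Q → Bool) {w : List M.Γ}
    (hg : ∀ p, M.Halts ⟨p, [], w⟩ →
      Finsupp.linearCombination ℝ (fun y => (g y p).toReal) μ = M.haltVal M.Qacc ⟨p, [], w⟩)
    {q : M.Q} {u : List M.Γ} (h : M.Halts ⟨q, [], u ++ w⟩) :
    Finsupp.linearCombination ℝ (fun y => M.popVal (g y) q u) μ =
      M.haltVal M.Qacc ⟨q, [], u ++ w⟩ := by
  generalize hc : (⟨q, [], u ++ w⟩ : M.Config) = c at h
  induction h generalizing q u with
  | intro c hacc ih =>
  subst hc
  have h : M.Halts ⟨q, [], u ++ w⟩ := ⟨_, hacc⟩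
  by_cases hq : q ∈ M.Qhalt
  · simp only [popVal_of_mem _ hq, haltVal_of_mem hq]
    rw [linearCombination_const hμ]
    simp [Bool.toReal, accepting]
  · rcases u with _ | ⟨a, u⟩
    -- The segment has been popped, so exactly `w` is left and the means of `g` apply.
    · simp only [popVal_nil _ hq]
      exact hg q h
    · simp only [popVal_cons hM _ hq]
      rw [linearCombination_avg]
      refine Eq.trans ?_ (haltVal_nil hq h).symm
      refine avg_congr fun p v hp => ?_
      have := ih ⟨p, [], v ++ (u ++ w)⟩ (.lam _ _ _ _ _ _ hq hp) (q := p) (u := v ++ u) (by simp)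
      simpa using this

/-! ### Random annotations of a stack -/

variable (M)

/-- The probability of the function `f'` if its values are independent and `f' q` is true with the
probability `M.popVal f q [a]`. -/
noncomputable def samp (a : M.Γ) (f f' : M.Q → Bool) : ℝ :=
  ∏ q, if f' q then M.popVal f q [a] else 1 - M.popVal f q [a]

/-- The distribution of the annotations of the stack segment `v` if the stack below it has the
annotation `g`. Each symbol carries the annotation of the stack below it; the annotation of the
whole stack is the second component. -/
noncomputable def ann : List M.Γ → (M.Q → Bool) → (List (M.Γ × (M.Q → Bool)) × (M.Q → Bool) →₀ ℝ)
  | [], g => Finsupp.single ([], g) 1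
  | a :: v, g => Finsupp.linearCombination ℝ
      (fun y => ∑ f', Finsupp.single ((a, y.2) :: y.1, f') (M.samp a y.2 f')) (ann v g)

variable {M}

lemma samp_nonneg (hM : ∀ q ∉ M.Qhalt, ∀ a, M.total q none a ≤ 1) (a : M.Γ) (f f' : M.Q → Bool) :
    0 ≤ M.samp a f f' := by
  refine Finset.prod_nonneg fun q _ => ?_
  split_ifs
  · exact popVal_nonneg ..
  · exact sub_nonneg.2 (popVal_le_one hM ..)

lemma sum_samp (a : M.Γ) (f : M.Q → Bool) : ∑ f', M.samp a f f' = 1 := by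
  unfold samp
  rw [← Fintype.prod_sum (fun q (b : Bool) => if b then M.popVal f q [a] else 1 - M.popVal f q [a])]
  simp

/-- The marginal at `q`. Multiplying by the indicator of `f' q` replaces the factor for the value
false at `q` by 0; in the resulting product of sums the factor at `q` is `popVal f q [a]` and all
others are 1. -/
lemma sum_samp_mul (a : M.Γ) (f : M.Q → Bool) (q : M.Q) :
    ∑ f', M.samp a f f' * (f' q).toReal = M.popVal f q [a] := by
  have h : ∀ f', M.samp a f f' * (f' q).toReal = ∏ p, (if f' p then M.popVal f p [a] else
      if p = q then 0 else 1 - M.popVal f p [a]) := by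
    intro f'
    by_cases hq : f' q
    · rw [Bool.toReal, if_pos hq, mul_one]
      refine Finset.prod_congr rfl fun p _ => ?_
      by_cases hp : p = q
      · simp [hp, hq]
      · simp [hp]
    · rw [Finset.prod_eq_zero (Finset.mem_univ q) (by simp [hq])]
      simp [Bool.toReal, hq]
  simp only [h]
  rw [← Fintype.prod_sum (fun p (b : Bool) => if b then M.popVal f p [a] else
      if p = q then 0 else 1 - M.popVal f p [a]), Finset.prod_eq_single q]
  · simp
  · intro p _ hp
    simp [hp]
  · simp

lemma linearCombination_ann_cons (a : M.Γ) (v : List M.Γ) (g : M.Q → Bool)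
    (X : List (M.Γ × (M.Q → Bool)) × (M.Q → Bool) → ℝ) :
    Finsupp.linearCombination ℝ X (M.ann (a :: v) g) = Finsupp.linearCombination ℝ
      (fun y => ∑ f', M.samp a y.2 f' * X ((a, y.2) :: y.1, f')) (M.ann v g) := by
  rw [ann, Finsupp.apply_linearCombination]
  congr 2
  ext y
  simp

lemma linearCombination_one_ann (v : List M.Γ) (g : M.Q → Bool) :
    Finsupp.linearCombination ℝ (fun _ => (1 : ℝ)) (M.ann v g) = 1 := by
  induction v with
  | nil => simp [ann]
  | cons a v ih => simp [linearCombination_ann_cons, sum_samp, ih]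

/-- The annotation of the whole stack is not written on it, so the last draw sums out. -/
lemma linearCombination_ann_cons_fst (a : M.Γ) (v : List M.Γ) (g : M.Q → Bool)
    (X : List (M.Γ × (M.Q → Bool)) → ℝ) :
    Finsupp.linearCombination ℝ (fun y => X y.1) (M.ann (a :: v) g) =
      Finsupp.linearCombination ℝ (fun y => X ((a, y.2) :: y.1)) (M.ann v g) := by
  simp [linearCombination_ann_cons, ← Finset.sum_mul, sum_samp]

/-- A Markov property from the bottom upwards: the upper segment depends on the lower one only
through the annotation of the latter. -/
lemma linearCombination_ann_append (v w : List M.Γ) (g : M.Q → Bool)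
    (X : List (M.Γ × (M.Q → Bool)) × (M.Q → Bool) → ℝ) :
    Finsupp.linearCombination ℝ X (M.ann (v ++ w) g) = Finsupp.linearCombination ℝ
      (fun y => Finsupp.linearCombination ℝ (fun z => X (z.1 ++ y.1, z.2)) (M.ann v y.2))
      (M.ann w g) := by
  induction v generalizing X with
  | nil => simp [ann]
  | cons a v ih =>
    rw [List.cons_append, linearCombination_ann_cons, ih]
    simp only [linearCombination_ann_cons, List.cons_append]

/-- An annotation of `v` above a stack with annotation `g`: the lowest symbol carries `g`. -/
def IsAnn (v : List M.Γ) (g : M.Q → Bool) (u : List (M.Γ × (M.Q → Bool))) : Prop :=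
  u.map Prod.fst = v ∧ ∀ v' z, v = v' ++ [z] → ∃ u', u = u' ++ [(z, g)]

/-- The clause for `v = []` carries the induction: the lowest symbol is placed on an empty segment
and so receives `g` itself. -/
lemma isWeight_ann (hM : ∀ q ∉ M.Qhalt, ∀ a, M.total q none a ≤ 1) (v : List M.Γ)
    (g : M.Q → Bool) : IsWeight (fun y => IsAnn v g y.1 ∧ (v = [] → y.2 = g)) (M.ann v g) := by
  induction v with
  | nil => exact IsWeight.single zero_le_one (by simp [IsAnn])
  | cons a v ih =>
    refine ih.linearCombination fun y hy => IsWeight.sum fun f' _ =>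
      IsWeight.single (samp_nonneg hM ..) ⟨⟨by simp [hy.1.1], fun v' z hv => ?_⟩, by simp⟩
    rcases v' with _ | ⟨b, v'⟩
    · obtain ⟨rfl, rfl⟩ : a = z ∧ v = [] := by simpa using hv
      have h1 : y.1 = [] := by simpa using hy.1.1
      exact ⟨[], by simp [h1, hy.2 rfl]⟩
    · obtain ⟨u', hu⟩ := hy.1.2 v' z (List.cons.inj hv).2
      exact ⟨(a, y.2) :: u', by simp [hu]⟩

/-- The annotation of a stack gives the right acceptance probabilities. -/
lemma linearCombination_ann_toReal (hM : ∀ q ∉ M.Qhalt, ∀ a, M.total q none a ≤ 1)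
    {q : M.Q} {w : List M.Γ} (h : M.Halts ⟨q, [], w⟩) :
    Finsupp.linearCombination ℝ (fun y => (y.2 q).toReal) (M.ann w M.accepting) =
      M.haltVal M.Qacc ⟨q, [], w⟩ := by
  induction w generalizing q with
  | nil =>
    by_cases hq : q ∈ M.Qhalt
    · rw [haltVal_of_mem hq]
      simp [ann, accepting, Bool.toReal]
    · rw [haltVal_empty hq]
      have : q ∉ M.Qacc := fun h => hq (Or.inl h)
      simp [ann, accepting, Bool.toReal, this]
  | cons a w ih =>
    rw [linearCombination_ann_cons]
    simp only [sum_samp_mul]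
    -- The annotation of `w` serves as the random `g`; its means are right by the induction
    -- hypothesis.
    exact linearCombination_popVal hM (linearCombination_one_ann w _) (fun y => y.2)
      (fun p hp => ih hp) (u := [a]) h

/-- The annotated moves: the string that is pushed is annotated at random. -/
noncomputable def annMoves (M : PPDA A) {Q' : Type*} (c : M.Q → Q') (q : M.Q) (σ : Option A)
    (a : M.Γ × (M.Q → Bool)) : Q' × List (M.Γ × (M.Q → Bool)) →₀ ℝ :=
  ∑ p, ∑ v ∈ M.Θ, M.δ q σ a.1 p v •
    Finsupp.linearCombination ℝ (fun y => Finsupp.single (c p, y.1) 1) (M.ann v a.2)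

lemma linearCombination_annMoves {Q' : Type*} (c : M.Q → Q') (q : M.Q) (σ : Option A)
    (a : M.Γ × (M.Q → Bool)) (X : Q' × List (M.Γ × (M.Q → Bool)) → ℝ) :
    Finsupp.linearCombination ℝ X (M.annMoves c q σ a) = M.avg q σ a.1 fun p v =>
      Finsupp.linearCombination ℝ (fun y => X (c p, y.1)) (M.ann v a.2) := by
  simp only [annMoves, avg, map_sum, map_smul, smul_eq_mul, Finsupp.apply_linearCombination]
  refine Finset.sum_congr rfl fun p _ => Finset.sum_congr rfl fun v _ => ?_
  congr 3
  ext y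
  simp

lemma linearCombination_one_annMoves {Q' : Type*} (c : M.Q → Q') (q : M.Q) (σ : Option A)
    (a : M.Γ × (M.Q → Bool)) :
    Finsupp.linearCombination ℝ (fun _ => (1 : ℝ)) (M.annMoves c q σ a) = M.total q σ a.1 := by
  simp [linearCombination_annMoves, linearCombination_one_ann, avg_one]

lemma isWeight_annMoves (hM : ∀ q ∉ M.Qhalt, ∀ a, M.total q none a ≤ 1) {Q' : Type*}
    (c : M.Q → Q') (q : M.Q) (σ : Option A) (a : M.Γ × (M.Q → Bool)) :
    IsWeight (fun y => ∃ p v, y.1 = c p ∧ 0 < M.δ q σ a.1 p v ∧ IsAnn v a.2 y.2)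
      (M.annMoves c q σ a) :=
  IsWeight.sum fun p _ => IsWeight.sum fun v _ => IsWeight.smul (δ_nonneg ..) fun hδ =>
    (isWeight_ann hM v a.2).linearCombination fun _ hy =>
      IsWeight.single zero_le_one ⟨p, v, rfl, hδ, hy.1⟩

/-- The lowest symbol pushed inherits the annotation of the symbol replaced, so the bottom cell
remains the same cell. A cell with symbol `z` and another annotation is an ordinary symbol and never
produces the marker. -/
lemma IsAnn.keepsBottom {z : M.Γ} {g : M.Q → Bool} {a : M.Γ × (M.Q → Bool)} {v : List M.Γ}
    {u : List (M.Γ × (M.Q → Bool))} (h : IsAnn v a.2 u) (hv : KeepsBottom z a.1 v) :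
    KeepsBottom (z, g) a u := by
  by_cases ha : a.1 = z
  · obtain ⟨v', hz, rfl⟩ := hv.2 ha
    obtain ⟨u', rfl⟩ := h.2 v' z rfl
    have hu' : u'.map Prod.fst = v' := by simpa using h.1
    have hz' : (z, g) ∉ u' := fun hmem => hz (hu' ▸ List.mem_map_of_mem hmem)
    constructor
    · intro hne
      simp only [List.mem_append, hz', List.mem_singleton, Prod.mk.injEq, true_and, false_or]
      exact fun hg => hne (Prod.ext ha hg.symm)
    · rintro rfl
      exact ⟨u', hz', rfl⟩
  · constructor
    · intro _ hmem
      exact hv.1 ha (h.1 ▸ List.mem_map_of_mem hmem)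
    · rintro rfl
      exact absurd rfl ha

end PPDA

/-! ### Removing endmarkers -/

/-- The states of the machine without endmarkers that simulates a machine with states `Q`: the
initial state, the final results, the simulation with the first input symbol still pending, and the
simulation afterwards, where each move is preceded by a choice of the result that is given if the
input ends here. -/
inductive FreeState (A Q : Type u) : Type u
  | init : FreeState A Q
  | fin : Bool → FreeState A Q
  | pend : A → Q → FreeState A Q
  | look : Q → FreeState A Q
  | ready : Q → Bool → FreeState A Q

namespace FreeState

instance {A Q : Type u} [Finite A] [Finite Q] : Finite (FreeState A Q) := by
  refine Finite.of_injective (β := (Unit ⊕ Bool) ⊕ ((A × Q) ⊕ (Q ⊕ (Q × Bool))))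
    (fun s => match s with
    | init => .inl (.inl ())
    | fin b => .inl (.inr b)
    | pend τ q => .inr (.inl (τ, q))
    | look q => .inr (.inr (.inl q))
    | ready q b => .inr (.inr (.inr (q, b)))) ?_
  intro s t h
  cases s <;> cases t <;> simp_all

noncomputable instance {A Q : Type u} [Finite A] [Finite Q] : Fintype (FreeState A Q) :=
  Fintype.ofFinite _

/-- The accepting states. -/
def accept {A Q : Type u} : Set (FreeState A Q) := {s | s = fin true ∨ ∃ q, s = ready q true}

end FreeState

namespace EndmarkerPPDA

open FreeState

variable {A : Type u} (M : EndmarkerPPDA A)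

/-- The stack symbols of the simulation: each one carries an annotation of the stack below it. -/
abbrev Cell : Type u := M.Γ × (M.Q → Bool)

/-- The bottom marker of the simulation. -/
noncomputable abbrev bottomCell : M.Cell := (M.Z₀, M.accepting)

/-- The acceptance probability weighted with the probability that the right endmarker is read
now. -/
noncomputable def endVal (q : M.Q) (a : M.Cell) : ℝ := M.avg q (some .right) a.1 fun p v =>
  Finsupp.linearCombination ℝ (fun y => (y.2 p).toReal) (M.ann v a.2)

/-- The acceptance probability if the right endmarker is read now. -/
noncomputable def endProb (q : M.Q) (a : M.Cell) : ℝ := M.endVal q a / M.total q (some .right) a.1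

/-- The moves of the simulation without endmarkers; `α` is the acceptance probability of the empty
input. -/
noncomputable def freeMoves (α : ℝ) :
    FreeState A M.Q → Option A → M.Cell → (FreeState A M.Q × List M.Cell →₀ ℝ)
  -- On the empty input the machine otherwise stops in `init`, which is rejecting.
  | init, none, a => if a = M.bottomCell then Finsupp.single (fin true, [a]) α else 0
  | init, some σ, a => if a = M.bottomCell ∧ M.q₀ ∉ M.Qhalt then
      M.annMoves (pend σ) M.q₀ (some .left) a else Finsupp.single (fin (M.accepting M.q₀), [a]) 1
  | fin _, none, _ => 0
  | fin b, some _, a => Finsupp.single (fin b, [a]) 1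
  -- The head has already passed `τ`, so consuming it is a λ-move.
  | pend τ q, none, a => if q ∈ M.Qhalt then Finsupp.single (fin (M.accepting q), [a]) 1 else
      M.annMoves (pend τ) q none a + M.annMoves look q (some (.sym τ)) a
  | pend _ _, some _, _ => 0
  -- The result drawn counts only if the machine stops next; the following move forgets it.
  | look q, none, a => if q ∈ M.Qhalt then Finsupp.single (fin (M.accepting q), [a]) 1 else
      Finsupp.single (ready q true, [a]) (M.endProb q a) +
        Finsupp.single (ready q false, [a]) (1 - M.endProb q a)
  | look _, some _, _ => 0
  | ready q _, none, a => if q ∈ M.Qhalt then 0 else M.annMoves look q none a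
  | ready q _, some σ, a => if q ∈ M.Qhalt then Finsupp.single (fin (M.accepting q), [a]) 1 else
      M.annMoves look q (some (.sym σ)) a

variable {M}

lemma endVal_nonneg (q : M.Q) (a : M.Cell) : 0 ≤ M.endVal q a := by
  refine PPDA.avg_nonneg fun p v => ?_
  have := (PPDA.isWeight_ann (fun q hq a => M.total_none_le_one hq a) v a.2).linearCombination_mono
    (X := fun _ => 0) (Y := fun y => (y.2 p).toReal) fun y _ => Bool.toReal_nonneg _
  simpa [Finsupp.linearCombination_apply] using this

lemma endVal_le_total (q : M.Q) (a : M.Cell) : M.endVal q a ≤ M.total q (some .right) a.1 := by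
  rw [← PPDA.avg_one]
  refine PPDA.avg_mono fun p v => ?_
  rw [← PPDA.linearCombination_one_ann v a.2]
  exact (PPDA.isWeight_ann (fun q hq a => M.total_none_le_one hq a) v a.2).linearCombination_mono
    fun y _ => Bool.toReal_le_one _

lemma endProb_nonneg (q : M.Q) (a : M.Cell) : 0 ≤ M.endProb q a :=
  div_nonneg (endVal_nonneg q a) (PPDA.total_nonneg ..)

lemma endProb_le_one (q : M.Q) (a : M.Cell) : M.endProb q a ≤ 1 :=
  div_le_one_of_le₀ (endVal_le_total q a) (PPDA.total_nonneg ..)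

/-- If the total is 0, the quotient is 0 by convention, but then `endVal`, bounded by the total,
vanishes as well. -/
lemma endProb_mul_total (q : M.Q) (a : M.Cell) :
    M.endProb q a * M.total q (some .right) a.1 = M.endVal q a := by
  by_cases h : M.total q (some .right) a.1 = 0
  · rw [h, mul_zero]
    exact le_antisymm (endVal_nonneg q a) (h ▸ endVal_le_total q a)
  · exact div_mul_cancel₀ _ h

lemma linearCombination_ann_congr {w : List M.Γ} {g : M.Q → Bool}
    {X Y : List M.Cell × (M.Q → Bool) → ℝ} (h : ∀ y, y.1.map Prod.fst = w → X y = Y y) :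
    Finsupp.linearCombination ℝ X (M.ann w g) = Finsupp.linearCombination ℝ Y (M.ann w g) :=
  (PPDA.isWeight_ann (fun _ hq a => M.total_none_le_one hq a) w g).linearCombination_congr
    fun y hy => h y hy.1.1

lemma linearCombination_endVal (q : M.Q) (a : M.Γ) (w : List M.Γ) :
    Finsupp.linearCombination ℝ (fun y => M.endVal q (a, y.2)) (M.ann w M.accepting) =
      M.avg q (some .right) a fun p v => Finsupp.linearCombination ℝ
        (fun y => (y.2 p).toReal) (M.ann (v ++ w) M.accepting) := by
  unfold endVal
  rw [PPDA.linearCombination_avg]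
  simp only [PPDA.linearCombination_ann_append]

lemma haltVal_eq_accepting {q : M.Q} (hq : q ∈ M.Qhalt) (r : List (Marked A)) (w : List M.Γ) :
    M.haltVal M.Qacc ⟨q, r, w⟩ = (M.accepting q).toReal := by
  rw [PPDA.haltVal_of_mem hq]
  simp [Bool.toReal, PPDA.accepting]

lemma isWeight_annMoves' (c : M.Q → FreeState A M.Q) (q : M.Q) (σ : Option (Marked A))
    (a : M.Cell) : IsWeight (fun y => ∃ p v, y.1 = c p ∧ 0 < M.δ q σ a.1 p v ∧
      PPDA.IsAnn v a.2 y.2) (M.annMoves c q σ a) :=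
  PPDA.isWeight_annMoves (fun _ hq a => M.total_none_le_one hq a) c q σ a

lemma isWeight_freeMoves {α : ℝ} (hα : 0 ≤ α) (s : FreeState A M.Q) (σ : Option A) (a : M.Cell) :
    IsWeight (fun y => KeepsBottom M.bottomCell a y.2) (M.freeMoves α s σ a) := by
  have hs : ∀ (t : FreeState A M.Q) (c : ℝ), 0 ≤ c → IsWeight
      (fun y : FreeState A M.Q × List M.Cell => KeepsBottom M.bottomCell a y.2)
        (Finsupp.single (t, [a]) c) :=
    fun t c hc => IsWeight.single hc (KeepsBottom.singleton _ _)
  have hm : ∀ (c : M.Q → FreeState A M.Q) q σ, IsWeight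
      (fun y : FreeState A M.Q × List M.Cell => KeepsBottom M.bottomCell a y.2)
        (M.annMoves c q σ a) :=
    fun c q σ => (isWeight_annMoves' c q σ a).mono
      fun y ⟨p, v, _, h, hv⟩ => hv.keepsBottom (M.keepsBottom h)
  have h1 := fun q => sub_nonneg.2 (endProb_le_one (M := M) q a)
  rcases s with _ | b | ⟨τ, q⟩ | q | ⟨q, b⟩ <;> rcases σ with _ | σ <;> simp only [freeMoves] <;>
    (try split_ifs) <;>
    first
    | exact IsWeight.zero
    | exact hs _ _ zero_le_one
    | exact hs _ _ hα
    | exact hm _ _ _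
    | exact (hm _ _ _).add (hm _ _ _)
    | exact (hs _ _ (endProb_nonneg _ _)).add (hs _ _ (h1 _))

lemma total_left_q₀ (h : M.q₀ ∉ M.Qhalt) : M.total M.q₀ (some .left) M.Z₀ = 1 := by
  have := M.prob M.q₀ h .left M.Z₀
  rwa [M.start h, add_zero] at this

lemma linearCombination_one_freeMoves_init (α : ℝ) (σ : A) (a : M.Cell) :
    Finsupp.linearCombination ℝ (fun _ => (1 : ℝ)) (M.freeMoves α init (some σ) a) = 1 := by
  rw [freeMoves]
  split_ifs with h
  · rw [PPDA.linearCombination_one_annMoves, h.1, total_left_q₀ h.2]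
  · simp

lemma linearCombination_one_freeMoves {α : ℝ} (s : FreeState A M.Q) (a : M.Cell)
    (h : ¬ (s = init ∧ a = M.bottomCell)) (σ : A) :
    Finsupp.linearCombination ℝ (fun _ => (1 : ℝ)) (M.freeMoves α s (some σ) a) +
      Finsupp.linearCombination ℝ (fun _ => (1 : ℝ)) (M.freeMoves α s none a) = 1 := by
  rcases s with _ | b | ⟨τ, q⟩ | q | ⟨q, b⟩
  · rw [linearCombination_one_freeMoves_init, freeMoves, if_neg fun h' => h ⟨rfl, h'⟩, map_zero,
      add_zero]
  · simp [freeMoves]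
  · by_cases hq : q ∈ M.Qhalt
    · simp [freeMoves, hq]
    · simpa [freeMoves, hq, PPDA.linearCombination_one_annMoves, add_comm] using
        M.prob q hq (.sym τ) a.1
  · by_cases hq : q ∈ M.Qhalt <;> simp [freeMoves, hq]
  · by_cases hq : q ∈ M.Qhalt
    · simp [freeMoves, hq]
    · simpa [freeMoves, hq, PPDA.linearCombination_one_annMoves] using M.prob q hq (.sym σ) a.1

lemma linearCombination_one_freeMoves_le [Nonempty A] {α : ℝ} (hα : 0 ≤ α) (hα1 : α ≤ 1)
    (s : FreeState A M.Q) (σ : Option A) (a : M.Cell) :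
    Finsupp.linearCombination ℝ (fun _ => (1 : ℝ)) (M.freeMoves α s σ a) ≤ 1 := by
  have h0 : ∀ σ, 0 ≤ Finsupp.linearCombination ℝ (fun _ => (1 : ℝ)) (M.freeMoves α s σ a) :=
    fun σ => Finset.sum_nonneg fun y _ => by simpa using (isWeight_freeMoves hα s σ a y).1
  by_cases h : s = init ∧ a = M.bottomCell
  · obtain ⟨rfl, rfl⟩ := h
    rcases σ with _ | σ
    · simpa [freeMoves] using hα1
    · rw [linearCombination_one_freeMoves_init]
  · rcases σ with _ | σ
    · obtain ⟨σ⟩ := ‹Nonempty A›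
      have := linearCombination_one_freeMoves (α := α) s a h σ
      linarith [h0 (some σ)]
    · have := linearCombination_one_freeMoves (α := α) s a h σ
      linarith [h0 none]

variable (M) [Finite A] [Nonempty A]

/-- The simulation without endmarkers. -/
@[reducible]
noncomputable def freePPDA (α : ℝ) (hα : 0 ≤ α) (hα1 : α ≤ 1) : PPDA A :=
  PPDA.ofMoves (FreeState A M.Q) M.Cell (M.freeMoves α) init M.bottomCell accept acceptᶜ
    disjoint_compl_right (isWeight_freeMoves hα) (linearCombination_one_freeMoves_le hα hα1)

variable {M} {α : ℝ} {hα : 0 ≤ α} {hα1 : α ≤ 1}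

lemma avg_freePPDA (s : FreeState A M.Q) (σ : Option A) (a : M.Cell)
    (X : FreeState A M.Q → List M.Cell → ℝ) :
    (M.freePPDA α hα hα1).avg s σ a X =
      Finsupp.linearCombination ℝ (fun y => X y.1 y.2) (M.freeMoves α s σ a) :=
  PPDA.avg_ofMoves ..

lemma total_freePPDA (s : FreeState A M.Q) (σ : Option A) (a : M.Cell) :
    (M.freePPDA α hα hα1).total s σ a =
      Finsupp.linearCombination ℝ (fun _ => (1 : ℝ)) (M.freeMoves α s σ a) := by
  rw [← PPDA.avg_one, avg_freePPDA]

lemma lamAvg_freePPDA {x : List A} {s : FreeState A M.Q} (hs : s ≠ init) (a : M.Cell)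
    (X : FreeState A M.Q → List M.Cell → ℝ) :
    (M.freePPDA α hα hα1).lamAvg x s a X =
      Finsupp.linearCombination ℝ (fun y => X y.1 y.2) (M.freeMoves α s none a) := by
  rw [PPDA.lamAvg, if_neg fun h => hs h.2.1, avg_freePPDA]

lemma pos_of_lamδ_pos {x : List A} {s : FreeState A M.Q} {a : M.Cell} {p : FreeState A M.Q}
    {v : List M.Cell} (h : 0 < (M.freePPDA α hα hα1).lamδ x s a p v) :
    0 < M.freeMoves α s none a (p, v) := by
  unfold PPDA.lamδ at h
  split_ifs at h
  · exact absurd h (lt_irrefl _)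
  · exact h

/-! ### Termination of the simulation -/

lemma freeHalts_fin (x : List A) (b : Bool) (r : List A) (w : List M.Cell) :
    (M.freePPDA α hα hα1).FreeHalts x ⟨fin b, r, w⟩ := by
  induction r generalizing w with
  | nil =>
    refine ⟨_, fun c h => ?_⟩
    cases h with
    | lam _ _ _ _ _ _ hp => exact absurd (pos_of_lamδ_pos hp) (lt_irrefl _)
  | cons σ r ih =>
    refine ⟨_, fun c h => ?_⟩
    cases h with
    | lam _ _ _ _ _ _ hp => exact absurd (pos_of_lamδ_pos hp) (lt_irrefl _)
    | read _ _ _ _ _ p v hp =>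
      obtain ⟨rfl, rfl⟩ := Prod.ext_iff.1 (eq_of_single_pos hp)
      exact ih _

/-- Stated with termination of the successors as a hypothesis, so that `freeHalts_look` can use its
induction hypothesis although the simulation makes two moves for one of `M`. -/
lemma freeHalts_ready {x : List A} {q : M.Q} {b : Bool} {r : List A} {w : List M.Cell}
    (h : ∀ c, M.Step ⟨q, Marked.rest r, w.map Prod.fst⟩ c → ∀ p r' w', c = ⟨p, Marked.rest r',
      w'.map Prod.fst⟩ → (M.freePPDA α hα hα1).FreeHalts x ⟨look p, r', w'⟩) :
    (M.freePPDA α hα hα1).FreeHalts x ⟨ready q b, r, w⟩ := by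
  refine ⟨_, fun c hs => ?_⟩
  cases hs with
  | lam _ _ a w p v hp =>
    have hp := pos_of_lamδ_pos hp
    rw [freeMoves] at hp
    split_ifs at hp with hq
    · exact absurd hp (lt_irrefl _)
    · obtain ⟨p, v', rfl, hδ, hv⟩ := (isWeight_annMoves' look q none a (p, v)).2 hp
      exact h _ (.lam _ _ _ _ _ _ hq hδ) _ _ _ (by simp [← hv.1])
  | read _ σ r a w p v hp =>
    change 0 < M.freeMoves α (ready q b) (some σ) a (p, v) at hp
    rw [freeMoves] at hp
    split_ifs at hp with hq
    · obtain ⟨rfl, rfl⟩ := Prod.ext_iff.1 (eq_of_single_pos hp)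
      exact freeHalts_fin ..
    · obtain ⟨p, v', rfl, hδ, hv⟩ := (isWeight_annMoves' look q _ a (p, v)).2 hp
      exact h _ (.read _ _ _ _ _ _ _ hq hδ) _ _ _ (by simp [← hv.1, Marked.rest])

lemma freeHalts_look {x : List A} {q : M.Q} {r : List A} {w : List M.Cell}
    (h : M.Halts ⟨q, Marked.rest r, w.map Prod.fst⟩) :
    (M.freePPDA α hα hα1).FreeHalts x ⟨look q, r, w⟩ := by
  generalize hc : (⟨q, Marked.rest r, w.map Prod.fst⟩ : M.Config) = c at h
  induction h generalizing q r w with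
  | intro c hacc ih =>
  subst hc
  refine ⟨_, fun c hs => ?_⟩
  cases hs with
  | lam _ _ a w p v hp =>
    have hp := pos_of_lamδ_pos hp
    rw [freeMoves] at hp
    split_ifs at hp with hq
    · obtain ⟨rfl, rfl⟩ := Prod.ext_iff.1 (eq_of_single_pos hp)
      exact freeHalts_fin ..
    · have hw : IsWeight (fun y : FreeState A M.Q × List M.Cell => ∃ b, y = (ready q b, [a]))
          (Finsupp.single (ready q true, [a]) (M.endProb q a) +
            Finsupp.single (ready q false, [a]) (1 - M.endProb q a)) :=
        (IsWeight.single (endProb_nonneg q a) ⟨_, rfl⟩).add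
          (IsWeight.single (sub_nonneg.2 (endProb_le_one q a)) ⟨_, rfl⟩)
      obtain ⟨b, hb⟩ := (hw (p, v)).2 hp
      obtain ⟨rfl, rfl⟩ := Prod.ext_iff.1 hb
      exact freeHalts_ready fun c hc p r' w' he => ih c hc he.symm
  | read _ σ r a w p v hp => exact absurd hp (lt_irrefl _)

lemma freeHalts_pend {x : List A} {τ : A} {q : M.Q} {r : List A} {w : List M.Cell}
    (h : M.Halts ⟨q, .sym τ :: Marked.rest r, w.map Prod.fst⟩) :
    (M.freePPDA α hα hα1).FreeHalts x ⟨pend τ q, r, w⟩ := by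
  generalize hc : (⟨q, .sym τ :: Marked.rest r, w.map Prod.fst⟩ : M.Config) = c at h
  induction h generalizing q w with
  | intro c hacc ih =>
  subst hc
  refine ⟨_, fun c hs => ?_⟩
  cases hs with
  | lam _ _ a w p v hp =>
    have hp := pos_of_lamδ_pos hp
    rw [freeMoves] at hp
    split_ifs at hp with hq
    · obtain ⟨rfl, rfl⟩ := Prod.ext_iff.1 (eq_of_single_pos hp)
      exact freeHalts_fin ..
    · have hw := ((isWeight_annMoves' (pend τ) q none a).mono fun _ hy => Or.inl hy).add
        ((isWeight_annMoves' look q (some (.sym τ)) a).mono fun _ hy => Or.inr hy)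
      rcases (hw (p, v)).2 hp with ⟨p, v', rfl, hδ, hv⟩ | ⟨p, v', rfl, hδ, hv⟩
      · exact ih _ (.lam _ _ _ _ _ _ hq hδ) (by simp [← hv.1])
      · have := hacc _ (.read _ _ _ _ _ _ _ hq hδ)
        rw [← hv.1, ← List.map_append] at this
        exact freeHalts_look this
  | read _ σ r a w p v hp => exact absurd hp (lt_irrefl _)

lemma freeHalts_init (x : List A) :
    (M.freePPDA α hα hα1).FreeHalts x ⟨init, x, [M.bottomCell]⟩ := by
  refine ⟨_, fun c hs => ?_⟩
  cases hs with
  | lam _ _ a w p v hp =>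
    have hp := pos_of_lamδ_pos hp
    rw [freeMoves, if_pos rfl] at hp
    obtain ⟨rfl, rfl⟩ := Prod.ext_iff.1 (eq_of_single_pos hp)
    exact freeHalts_fin ..
  | read _ σ r a w p v hp =>
    change 0 < M.freeMoves α init (some σ) M.bottomCell (p, v) at hp
    rw [freeMoves] at hp
    split_ifs at hp with hq
    · obtain ⟨p, v', rfl, hδ, hv⟩ := (isWeight_annMoves' (pend σ) _ _ _ (p, v)).2 hp
      have : M.Halts ⟨p, .sym σ :: Marked.rest r, v' ++ []⟩ :=
        (M.halts_init (σ :: r)).step (.read _ _ _ _ _ _ _ hq.2 hδ)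
      rw [← hv.1, ← List.map_nil (f := Prod.fst), ← List.map_append] at this
      exact freeHalts_pend this
    · obtain ⟨rfl, rfl⟩ := Prod.ext_iff.1 (eq_of_single_pos hp)
      exact freeHalts_fin ..

variable (M)

/-- A machine with endmarkers as a machine without endmarkers; `α` is the acceptance probability of
the empty input. -/
noncomputable def toNoEndmarker (α : ℝ) (hα : 0 ≤ α) (hα1 : α ≤ 1) : NoEndmarkerPPDA A where
  toPPDA := M.freePPDA α hα hα1
  cover := Set.union_compl_self _
  prob s a h σ := by
    rw [total_freePPDA, total_freePPDA]
    exact linearCombination_one_freeMoves s a h σ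
  start_read σ := by
    rw [total_freePPDA]
    exact linearCombination_one_freeMoves_init α σ _
  start_lam := by
    rw [total_freePPDA]
    exact linearCombination_one_freeMoves_le hα hα1 _ _ _
  finite_paths x h := not_acc_iff_exists_descending_chain.2 h (freeHalts_init x)

variable {M}

/-! ### The acceptance probability of the simulation -/

/-- The acceptance probability of a configuration of the simulation. -/
noncomputable abbrev freeVal (M : EndmarkerPPDA A) (α : ℝ) (hα : 0 ≤ α) (hα1 : α ≤ 1) (x : List A)
    (s : FreeState A M.Q) (r : List A) (w : List M.Cell) : ℝ :=
  (M.freePPDA α hα hα1).stopVal x accept ⟨s, r, w⟩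

lemma freeVal_fin (x : List A) (b : Bool) (r : List A) (a : M.Cell) (w : List M.Cell) :
    M.freeVal α hα hα1 x (fin b) r (a :: w) = b.toReal := by
  induction r with
  | nil =>
    refine (PPDA.stopVal_nil _ (freeHalts_fin ..)).trans ?_
    rw [lamAvg_freePPDA (by simp), lamAvg_freePPDA (by simp), freeMoves]
    simp [accept, Bool.toReal]
  | cons σ r ih =>
    refine (PPDA.stopVal_cons _ (freeHalts_fin ..)).trans ?_
    rw [lamAvg_freePPDA (by simp), avg_freePPDA, freeMoves, freeMoves, map_zero, zero_add,
      Finsupp.linearCombination_single, one_smul]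
    exact ih

/-- Meant for `look` and `pend`: being rejecting, they contribute nothing to acceptance by stopping.
-/
lemma freeVal_lam_of_ne {x : List A} {s : FreeState A M.Q} (hs : s ≠ init) (hs' : s ∉ accept)
    (hread : ∀ σ a, M.freeMoves α s (some σ) a = 0) {r : List A} {a : M.Cell} {w : List M.Cell}
    (h : (M.freePPDA α hα hα1).FreeHalts x ⟨s, r, a :: w⟩) :
    M.freeVal α hα hα1 x s r (a :: w) = Finsupp.linearCombination ℝ
      (fun y => M.freeVal α hα hα1 x y.1 r (y.2 ++ w)) (M.freeMoves α s none a) := by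
  rcases r with _ | ⟨σ, r⟩
  · refine (PPDA.stopVal_nil _ h).trans ?_
    rw [lamAvg_freePPDA hs, lamAvg_freePPDA hs, if_neg hs', zero_add]
  · refine (PPDA.stopVal_cons _ h).trans ?_
    rw [lamAvg_freePPDA hs, avg_freePPDA, hread, map_zero, add_zero]

/-- The average over the moves of `M` of the value of the simulation afterwards. -/
noncomputable def nextVal (M : EndmarkerPPDA A) (α : ℝ) (hα : 0 ≤ α) (hα1 : α ≤ 1) (x : List A)
    (c : M.Q → FreeState A M.Q) (q : M.Q) (σ : Option (Marked A)) (r : List A) (a : M.Cell)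
    (w : List M.Cell) : ℝ :=
  M.avg q σ a.1 fun p v => Finsupp.linearCombination ℝ
    (fun z => M.freeVal α hα hα1 x (c p) r (z.1 ++ w)) (M.ann v a.2)

lemma freeVal_look_of_mem {x : List A} {q : M.Q} (hq : q ∈ M.Qhalt) {r : List A} {a : M.Cell}
    {w : List M.Cell} (h : M.Halts ⟨q, Marked.rest r, (a :: w).map Prod.fst⟩) :
    M.freeVal α hα hα1 x (look q) r (a :: w) = (M.accepting q).toReal := by
  rw [freeVal_lam_of_ne (by simp) (by simp [accept]) (fun _ _ => rfl) (freeHalts_look h),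
    freeMoves, if_pos hq, Finsupp.linearCombination_single, one_smul]
  exact freeVal_fin ..

lemma freeVal_look {x : List A} {q : M.Q} (hq : q ∉ M.Qhalt) {r : List A} {a : M.Cell}
    {w : List M.Cell} (h : M.Halts ⟨q, Marked.rest r, (a :: w).map Prod.fst⟩) :
    M.freeVal α hα hα1 x (look q) r (a :: w) =
      M.endProb q a * M.freeVal α hα hα1 x (ready q true) r (a :: w) +
        (1 - M.endProb q a) * M.freeVal α hα hα1 x (ready q false) r (a :: w) := by
  rw [freeVal_lam_of_ne (by simp) (by simp [accept]) (fun _ _ => rfl) (freeHalts_look h),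
    freeMoves, if_neg hq]
  simp [sub_mul]

lemma freeHalts_ready_of_halts {x : List A} {q : M.Q} {b : Bool} {r : List A} {w : List M.Cell}
    (h : M.Halts ⟨q, Marked.rest r, w.map Prod.fst⟩) :
    (M.freePPDA α hα hα1).FreeHalts x ⟨ready q b, r, w⟩ :=
  freeHalts_ready fun c hc p r' w' he => freeHalts_look (by subst he; exact h.step hc)

/-- The drawn result takes effect with the stopping probability, and `endProb` times this
probability is `endVal`: the draw contributes exactly what the move on `$` would. -/
lemma freeVal_look_nil {x : List A} {q : M.Q} (hq : q ∉ M.Qhalt) {a : M.Cell}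
    {w : List M.Cell} (h : M.Halts ⟨q, Marked.rest [], (a :: w).map Prod.fst⟩) :
    M.freeVal α hα hα1 x (look q) [] (a :: w) =
      M.nextVal α hα hα1 x look q none [] a w + M.endVal q a := by
  have hready : ∀ b, M.freeVal α hα hα1 x (ready q b) [] (a :: w) =
      b.toReal * M.total q (some .right) a.1 + M.nextVal α hα hα1 x look q none [] a w := by
    intro b
    refine (PPDA.stopVal_nil _ (freeHalts_ready_of_halts h)).trans ?_
    rw [lamAvg_freePPDA (by simp), lamAvg_freePPDA (by simp), freeMoves, if_neg hq,
      PPDA.linearCombination_one_annMoves, PPDA.linearCombination_annMoves]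
    -- The stopping probability is what the λ-moves leave over, that is, the total on `$`.
    have := M.prob q hq .right a.1
    rw [← this, add_sub_cancel_right]
    refine congrArg₂ _ ?_ rfl
    cases b <;> simp [accept, Bool.toReal]
  rw [freeVal_look hq h, hready, hready, ← endProb_mul_total]
  simp only [Bool.toReal, if_true, Bool.false_eq_true, if_false]
  ring

/-- While input is left, the value after the draw does not depend on its result. -/
lemma freeVal_look_cons {x : List A} {q : M.Q} (hq : q ∉ M.Qhalt) {σ : A} {r : List A}
    {a : M.Cell} {w : List M.Cell}
    (h : M.Halts ⟨q, Marked.rest (σ :: r), (a :: w).map Prod.fst⟩) :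
    M.freeVal α hα hα1 x (look q) (σ :: r) (a :: w) =
      M.nextVal α hα hα1 x look q none (σ :: r) a w +
        M.nextVal α hα hα1 x look q (some (.sym σ)) r a w := by
  have hready : ∀ b, M.freeVal α hα hα1 x (ready q b) (σ :: r) (a :: w) =
      M.nextVal α hα hα1 x look q none (σ :: r) a w +
        M.nextVal α hα hα1 x look q (some (.sym σ)) r a w := by
    intro b
    refine (PPDA.stopVal_cons _ (freeHalts_ready_of_halts h)).trans ?_
    rw [lamAvg_freePPDA (by simp), avg_freePPDA, freeMoves, if_neg hq, freeMoves, if_neg hq,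
      PPDA.linearCombination_annMoves, PPDA.linearCombination_annMoves]
    rfl
  rw [freeVal_look hq h, hready, hready]
  ring

lemma freeVal_pend_of_mem {x : List A} {τ : A} {q : M.Q} (hq : q ∈ M.Qhalt) {r : List A}
    {a : M.Cell} {w : List M.Cell}
    (h : M.Halts ⟨q, .sym τ :: Marked.rest r, (a :: w).map Prod.fst⟩) :
    M.freeVal α hα hα1 x (pend τ q) r (a :: w) = (M.accepting q).toReal := by
  rw [freeVal_lam_of_ne (by simp) (by simp [accept]) (fun _ _ => rfl) (freeHalts_pend h),
    freeMoves, if_pos hq, Finsupp.linearCombination_single, one_smul]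
  exact freeVal_fin ..

lemma freeVal_pend {x : List A} {τ : A} {q : M.Q} (hq : q ∉ M.Qhalt) {r : List A}
    {a : M.Cell} {w : List M.Cell}
    (h : M.Halts ⟨q, .sym τ :: Marked.rest r, (a :: w).map Prod.fst⟩) :
    M.freeVal α hα hα1 x (pend τ q) r (a :: w) =
      M.nextVal α hα hα1 x (pend τ) q none r a w +
        M.nextVal α hα hα1 x look q (some (.sym τ)) r a w := by
  rw [freeVal_lam_of_ne (by simp) (by simp [accept]) (fun _ _ => rfl) (freeHalts_pend h),
    freeMoves, if_neg hq, map_add, PPDA.linearCombination_annMoves,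
    PPDA.linearCombination_annMoves]
  rfl

/-- Averaging over the annotations of the stack commutes with a move. -/
lemma linearCombination_nextVal (x : List A) (c : M.Q → FreeState A M.Q) (q : M.Q)
    (σ : Option (Marked A)) (r : List A) (a : M.Γ) (w : List M.Γ) :
    Finsupp.linearCombination ℝ (fun y => M.nextVal α hα hα1 x c q σ r (a, y.2) y.1)
      (M.ann w M.accepting) = M.avg q σ a fun p v => Finsupp.linearCombination ℝ
        (fun y => M.freeVal α hα hα1 x (c p) r y.1) (M.ann (v ++ w) M.accepting) := by
  unfold nextVal
  rw [PPDA.linearCombination_avg]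
  simp only [PPDA.linearCombination_ann_append]

/-- After the first symbol, the simulation has the right acceptance probability on average. -/
lemma linearCombination_freeVal_look (x : List A) {q : M.Q} {r : List A} {w : List M.Γ}
    (h : M.Halts ⟨q, Marked.rest r, w⟩) (hw : ∃ u, w = u ++ [M.Z₀]) :
    Finsupp.linearCombination ℝ (fun y => M.freeVal α hα hα1 x (look q) r y.1)
      (M.ann w M.accepting) = M.haltVal M.Qacc ⟨q, Marked.rest r, w⟩ := by
  generalize hc : (⟨q, Marked.rest r, w⟩ : M.Config) = c at h
  induction h generalizing q r w with
  | intro c hacc ih =>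
  subst hc
  have h : M.Halts ⟨q, Marked.rest r, w⟩ := ⟨_, hacc⟩
  obtain ⟨a, w, rfl⟩ : ∃ a w', w = a :: w' := by
    obtain ⟨u, rfl⟩ := hw
    cases u <;> simp
  rw [PPDA.linearCombination_ann_cons_fst]
  have h' : ∀ y : List M.Cell × (M.Q → Bool), y.1.map Prod.fst = w →
      M.Halts ⟨q, Marked.rest r, ((a, y.2) :: y.1).map Prod.fst⟩ := by
    rintro y rfl
    exact h
  by_cases hq : q ∈ M.Qhalt
  · rw [linearCombination_ann_congr fun y hy => freeVal_look_of_mem hq (h' y hy),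
      linearCombination_const (PPDA.linearCombination_one_ann ..), haltVal_eq_accepting hq]
  · have hlam : M.avg q none a (fun p v => Finsupp.linearCombination ℝ
        (fun y => M.freeVal α hα hα1 x (look p) r y.1) (M.ann (v ++ w) M.accepting)) =
        M.avg q none a fun p v => M.haltVal M.Qacc ⟨p, Marked.rest r, v ++ w⟩ :=
      PPDA.avg_congr fun p v hp =>
        ih _ (.lam _ _ _ _ _ _ hq hp) (PPDA.bottom_append hw hp) rfl
    rcases r with _ | ⟨σ, r⟩
    · rw [linearCombination_ann_congr fun y hy => freeVal_look_nil hq (h' y hy),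
        linearCombination_add_fun, linearCombination_nextVal, linearCombination_endVal, hlam]
      refine Eq.trans ?_ (PPDA.haltVal_cons hq h).symm
      congr 1
      -- After `$` the predictions for the new stack `v ++ w` average to its acceptance probability.
      exact PPDA.avg_congr fun p v hp => PPDA.linearCombination_ann_toReal
        (fun _ hq a => M.total_none_le_one hq a) (h.step (.read _ _ _ _ _ _ _ hq hp))
    · rw [linearCombination_ann_congr fun y hy => freeVal_look_cons hq (h' y hy),
        linearCombination_add_fun, linearCombination_nextVal, linearCombination_nextVal, hlam]
      refine Eq.trans ?_ (PPDA.haltVal_cons hq h).symm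
      congr 1
      exact PPDA.avg_congr fun p v hp =>
        ih _ (.read _ _ _ _ _ _ _ hq hp) (PPDA.bottom_append hw hp) rfl

/-- While the first symbol is pending, the simulation has the right acceptance probability on
average. -/
lemma linearCombination_freeVal_pend (x : List A) {τ : A} {q : M.Q} {r : List A} {w : List M.Γ}
    (h : M.Halts ⟨q, .sym τ :: Marked.rest r, w⟩) (hw : ∃ u, w = u ++ [M.Z₀]) :
    Finsupp.linearCombination ℝ (fun y => M.freeVal α hα hα1 x (pend τ q) r y.1)
      (M.ann w M.accepting) = M.haltVal M.Qacc ⟨q, .sym τ :: Marked.rest r, w⟩ := by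
  generalize hc : (⟨q, .sym τ :: Marked.rest r, w⟩ : M.Config) = c at h
  induction h generalizing q w with
  | intro c hacc ih =>
  subst hc
  have h : M.Halts ⟨q, .sym τ :: Marked.rest r, w⟩ := ⟨_, hacc⟩
  obtain ⟨a, w, rfl⟩ : ∃ a w', w = a :: w' := by
    obtain ⟨u, rfl⟩ := hw
    cases u <;> simp
  rw [PPDA.linearCombination_ann_cons_fst]
  have h' : ∀ y : List M.Cell × (M.Q → Bool), y.1.map Prod.fst = w →
      M.Halts ⟨q, .sym τ :: Marked.rest r, ((a, y.2) :: y.1).map Prod.fst⟩ := by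
    rintro y rfl
    exact h
  by_cases hq : q ∈ M.Qhalt
  · rw [linearCombination_ann_congr fun y hy => freeVal_pend_of_mem hq (h' y hy),
      linearCombination_const (PPDA.linearCombination_one_ann ..), haltVal_eq_accepting hq]
  · rw [linearCombination_ann_congr fun y hy => freeVal_pend hq (h' y hy),
      linearCombination_add_fun, linearCombination_nextVal, linearCombination_nextVal]
    refine Eq.trans ?_ (PPDA.haltVal_cons hq h).symm
    congr 1
    · exact PPDA.avg_congr fun p v hp =>
        ih _ (.lam _ _ _ _ _ _ hq hp) (PPDA.bottom_append hw hp) rfl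
    · exact PPDA.avg_congr fun p v hp => linearCombination_freeVal_look x
        (h.step (.read _ _ _ _ _ _ _ hq hp)) (PPDA.bottom_append hw hp)

lemma freeVal_init_nil : M.freeVal α hα hα1 [] init [] [M.bottomCell] = α := by
  refine (PPDA.stopVal_nil _ (freeHalts_init [])).trans ?_
  rw [if_neg (by simp [accept]), PPDA.lamAvg, if_neg (by simp), avg_freePPDA, freeMoves,
    if_pos rfl, Finsupp.linearCombination_single, zero_add]
  change α * M.freeVal α hα hα1 [] (fin true) [] [M.bottomCell] = α
  rw [freeVal_fin]
  simp [Bool.toReal]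

lemma freeVal_init_cons (σ : A) (r : List A) :
    M.freeVal α hα hα1 (σ :: r) init (σ :: r) [M.bottomCell] =
      M.haltVal M.Qacc (M.init (Marked.tape (σ :: r))) := by
  refine (PPDA.stopVal_cons _ (freeHalts_init (σ :: r))).trans ?_
  rw [PPDA.lamAvg, if_pos (by simp), zero_add, avg_freePPDA, freeMoves]
  by_cases hq : M.q₀ ∈ M.Qhalt
  · rw [if_neg (by simp [hq]), Finsupp.linearCombination_single, one_smul]
    exact (freeVal_fin ..).trans (haltVal_eq_accepting hq _ _).symm
  · have hM := M.halts_init (σ :: r)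
    rw [if_pos ⟨rfl, hq⟩, PPDA.linearCombination_annMoves]
    refine Eq.trans ?_ (PPDA.haltVal_cons hq hM).symm
    rw [PPDA.avg_eq_zero_of_total (M.start hq), zero_add]
    refine PPDA.avg_congr fun p v hp => ?_
    have := linearCombination_freeVal_pend (α := α) (hα := hα) (hα1 := hα1) (σ :: r)
      (hM.step (.read _ _ _ _ _ _ _ hq hp)) (PPDA.bottom_append ⟨[], rfl⟩ hp)
    refine Eq.trans ?_ this
    simp

lemma accProb_toNoEndmarker (h0 : α = M.accProb []) (x : List A) :
    (M.toNoEndmarker α hα hα1).accProb x = M.accProb x := by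
  rcases x with _ | ⟨σ, r⟩
  · rw [← h0]
    exact freeVal_init_nil (hα := hα) (hα1 := hα1)
  · exact freeVal_init_cons (hα := hα) (hα1 := hα1) σ r

end EndmarkerPPDA

/-! ### The equivalence -/

theorem theorem1 {A : Type u} [Finite A] [Nonempty A] (L : Language A) (ε : List A → ℝ)
    (hε : (∀ x, 0 ≤ ε x ∧ ε x < 1 / 2) ∨ IsOneSidedBound L ε) :
    (∃ M : EndmarkerPPDA A, RecognizesWithError M.accProb M.rejProb L ε) ↔
      (∃ N : NoEndmarkerPPDA A, RecognizesWithError N.accProb N.rejProb L ε) := by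
  constructor
  · rintro ⟨M, hM⟩
    have hsum : ∀ x, M.accProb x + M.rejProb x = 1 := by
      intro x
      by_cases hx : x ∈ L
      · rw [((hM x).1 hx).1, ((hM x).1 hx).2]
        ring
      · rw [((hM x).2 hx).1, ((hM x).2 hx).2]
        ring
    have hacc : 0 ≤ M.accProb [] := tsum_nonneg fun n => PPDA.haltProb_nonneg ..
    have hrej : 0 ≤ M.rejProb [] := tsum_nonneg fun n => PPDA.haltProb_nonneg ..
    have hacc1 : M.accProb [] ≤ 1 := by linarith [hsum []]
    refine ⟨M.toNoEndmarker _ hacc hacc1, ?_⟩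
    have h1 : (M.toNoEndmarker _ hacc hacc1).accProb = M.accProb :=
      funext fun x => EndmarkerPPDA.accProb_toNoEndmarker rfl x
    -- Both machines decide with probability one, so equal acceptance gives equal rejection.
    have h2 : (M.toNoEndmarker _ hacc hacc1).rejProb = M.rejProb := funext fun x => by
      have := (M.toNoEndmarker _ hacc hacc1).accProb_add_rejProb x
      rw [h1] at this
      linarith [hsum x]
    rwa [h1, h2]
  · rintro ⟨N, hN⟩
    refine ⟨N.toEndmarker, ?_⟩
    rwa [funext N.accProb_toEndmarker, funext N.rejProb_toEndmarker]
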